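/- For a finite simple graph $G$ let $\rho(G)$ be the largest eigenvalue of its adjacency matrix. For a graph $F$, a graph is $F$-free if it contains no (not necessarily induced) subgraph isomorphic to $F$; let $\mathrm{spex}(n,F)$ be the maximum of $\rho(G)$ over all $F$-free graphs $G$ of order $n$, and let $\mathrm{SPEX}(n,F)$ be the family, up to isomorphism, of $F$-free graphs $G$ of order $n$ with $\rho(G)=\mathrm{spex}(n,F)$. For $n>k>0$ and $0\le p\le\lfloor (n-k)/2\rfloor$ let $S_{n,k}^{p}$ be the graph obtained from the join $K_k\nabla (n-k)K_1$ by adding $p$ independent edges inside $(n-k)K_1$. Let $\beta(F)$ be the minimum size of a set of vertices of $F$ that meets all edges of $F$. **Theorem.** For every $\ell\ge 4$ there is $N=N(\ell)$ such that for every $n\ge N$ and every tree $F$ of order $\ell$, with partite sets $A$ and $B$, $|A|\le|B|$, and $\delta:=\min\{d_F(x):x\in A\}$, the following hold. (i) If $\ell$ is even, then $\mathrm{SPEX}(n,F)=\{S_{n,(\ell-2)/2}^{0}\}$ if and only if $\beta(F)=\ell/2$. (ii) If $\ell$ is odd, then $\mathrm{SPEX}(n,F)=\{S_{n,(\ell-3)/2}^{1}\}$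 if and only if $\beta(F)=(\ell-1)/2$ and $\delta\ge 2$. -/

import Mathlib

namespace SpectralTuran

/-- The spectral radius `ρ(G)` of a finite graph: the largest eigenvalue of its (real symmetric)
adjacency matrix. -/
noncomputable def rho {W : Type*} [Fintype W] (G : SimpleGraph W) : ℝ := by
  classical
  exact sSup (spectrum ℝ (G.adjMatrix ℝ))

/-- `spex(n, F)`: the maximum spectral radius over all `F`-free graphs of order `n`.
(The set is finite, and nonempty whenever `F` has an edge, so the supremum is a maximum.) -/
noncomputable def spex (n : ℕ) {V : Type*} (F : SimpleGraph V) : ℝ :=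
  sSup {r : ℝ | ∃ G : SimpleGraph (Fin n), F.Free G ∧ r = rho G}

/-- `SPEX(n, F)`: the `F`-free graphs of order `n` whose spectral radius is `spex(n, F)`,
as labelled graphs on `Fin n`. -/
def SPEX (n : ℕ) {V : Type*} (F : SimpleGraph V) : Set (SimpleGraph (Fin n)) :=
  {G | F.Free G ∧ rho G = spex n F}

/-- The graph `S_{n,k}^p` on `{0, …, n-1}`: the vertices `0, …, k-1` are adjacent to all other
vertices, and among the remaining `n - k` vertices the only edges are the `p` independent edges
`{k + 2t, k + 2t + 1}`, `t < p`. (Meant for `0 < k < n` and `p ≤ (n - k) / 2`.) -/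
def S (n k p : ℕ) : SimpleGraph (Fin n) :=
  SimpleGraph.fromRel fun i j =>
    i.val < k ∨ ∃ t < p, i.val = k + 2 * t ∧ j.val = k + 2 * t + 1

/-- The isomorphism class of a graph `H` on `Fin n`, as a family of labelled graphs on `Fin n`.
A family of graphs of order `n`, considered up to isomorphism, is `{H}` iff it equals this. -/
def isoClass {n : ℕ} (H : SimpleGraph (Fin n)) : Set (SimpleGraph (Fin n)) :=
  {G | Nonempty (G ≃g H)}

/-- The minimum of the degrees `d_F(x)` over `x ∈ A` (for nonempty `A`). -/
noncomputable def minDegreeOn {V : Type*} [Fintype V] (F : SimpleGraph V) (A : Finset V) : ℕ := by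
  classical
  exact sInf {d : ℕ | ∃ x ∈ A, d = F.degree x}

end SpectralTuran

namespace SpectralTuran

open Finset
open scoped Classical

section Spectral

variable {W : Type*} [Fintype W]

/-- Action of the adjacency matrix of `G` on a vector. -/
noncomputable def adjSum (G : SimpleGraph W) (x : W → ℝ) (v : W) : ℝ :=
  ∑ u with G.Adj v u, x u

lemma adjMatrix_mulVec_eq (G : SimpleGraph W) (x : W → ℝ) :
    (G.adjMatrix ℝ).mulVec x = adjSum G x := by
  funext v
  rw [SimpleGraph.adjMatrix_mulVec_apply, adjSum]
  exact Finset.sum_congr (by ext; simp) fun _ _ => rfl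

lemma isHermitian_adjMatrix {W : Type*} (G : SimpleGraph W) : (G.adjMatrix ℝ).IsHermitian := by
  simp [Matrix.IsHermitian, Matrix.conjTranspose_eq_transpose_of_trivial]

lemma le_rho {G : SimpleGraph W} {r : ℝ} (hr : r ∈ spectrum ℝ (G.adjMatrix ℝ)) : r ≤ rho G := by
  have h : (spectrum ℝ (G.adjMatrix ℝ)).Finite := by
    rw [(isHermitian_adjMatrix G).spectrum_real_eq_range_eigenvalues]
    exact Set.finite_range _
  exact le_csSup h.bddAbove hr

lemma posSemidef_rho_sub (G : SimpleGraph W) :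
    (algebraMap ℝ (Matrix W W ℝ) (rho G) - G.adjMatrix ℝ).PosSemidef := by
  have hH : (algebraMap ℝ (Matrix W W ℝ) (rho G) - G.adjMatrix ℝ).IsHermitian := by
    refine Matrix.IsHermitian.sub ?_ (isHermitian_adjMatrix G)
    simp [Matrix.IsHermitian, Matrix.algebraMap_eq_diagonal]
  rw [hH.posSemidef_iff_eigenvalues_nonneg]
  intro i
  have hi : hH.eigenvalues i ∈ spectrum ℝ (algebraMap ℝ (Matrix W W ℝ) (rho G) - G.adjMatrix ℝ) := by
    rw [hH.spectrum_real_eq_range_eigenvalues]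
    exact ⟨i, rfl⟩
  rw [← spectrum.singleton_sub_eq] at hi
  obtain ⟨a, ha, b, hb, hab⟩ := Set.mem_sub.mp hi
  have := le_rho hb
  simp only [Set.mem_singleton_iff] at ha
  change 0 ≤ hH.eigenvalues i
  linarith

lemma rho_sub_mulVec (G : SimpleGraph W) (x : W → ℝ) :
    (algebraMap ℝ (Matrix W W ℝ) (rho G) - G.adjMatrix ℝ).mulVec x =
      fun v => rho G * x v - adjSum G x v := by
  rw [Matrix.sub_mulVec, adjMatrix_mulVec_eq, Algebra.algebraMap_eq_smul_one, Matrix.smul_mulVec,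
    Matrix.one_mulVec]
  rfl

/-- The Rayleigh bound. -/
lemma sum_mul_adjSum_le (G : SimpleGraph W) (x : W → ℝ) :
    ∑ v, x v * adjSum G x v ≤ rho G * ∑ v, x v * x v := by
  have h := (posSemidef_rho_sub G).dotProduct_mulVec_nonneg x
  rw [rho_sub_mulVec] at h
  simp only [dotProduct, star_trivial, mul_sub, Finset.sum_sub_distrib] at h
  rw [Finset.mul_sum]
  calc _ ≤ ∑ v, x v * (rho G * x v) := by linarith
    _ = _ := Finset.sum_congr rfl fun _ _ => by ring

/-- A vector attaining the Rayleigh bound is an eigenvector. -/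
lemma adjSum_eq_of_le {G : SimpleGraph W} {x : W → ℝ}
    (h : rho G * ∑ v, x v * x v ≤ ∑ v, x v * adjSum G x v) (v : W) :
    adjSum G x v = rho G * x v := by
  have h0 := (posSemidef_rho_sub G).dotProduct_mulVec_zero_iff x
  rw [rho_sub_mulVec] at h0
  have h1 := h0.mp (by
    have := sum_mul_adjSum_le G x
    simp only [dotProduct, star_trivial, mul_sub, Finset.sum_sub_distrib]
    have e : ∑ v, x v * (rho G * x v) = rho G * ∑ v, x v * x v := by
      rw [Finset.mul_sum]
      exact Finset.sum_congr rfl fun _ _ => by ring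
    linarith)
  have := congrFun h1 v
  simp only [Pi.zero_apply] at this
  linarith

/-- The spectral radius has a nonnegative eigenvector, normalised to have maximum `1`. -/
lemma exists_perron [Nonempty W] (G : SimpleGraph W) :
    ∃ x : W → ℝ, (∀ v, 0 ≤ x v) ∧ (∀ v, x v ≤ 1) ∧ (∃ v, x v = 1) ∧
      ∀ v, adjSum G x v = rho G * x v := by
  have hne : (spectrum ℝ (G.adjMatrix ℝ)).Nonempty := by
    rw [(isHermitian_adjMatrix G).spectrum_real_eq_range_eigenvalues]
    exact Set.range_nonempty _
  have hfin : (spectrum ℝ (G.adjMatrix ℝ)).Finite := by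
    rw [(isHermitian_adjMatrix G).spectrum_real_eq_range_eigenvalues]
    exact Set.finite_range _
  have hmem : rho G ∈ spectrum ℝ (G.adjMatrix ℝ) := hne.csSup_mem hfin
  rw [(isHermitian_adjMatrix G).spectrum_real_eq_range_eigenvalues] at hmem
  obtain ⟨i, hi⟩ := hmem
  set y : W → ℝ := ⇑((isHermitian_adjMatrix G).eigenvectorBasis i) with hy
  have hAy : ∀ v, adjSum G y v = rho G * y v := by
    intro v
    have := congrFun ((isHermitian_adjMatrix G).mulVec_eigenvectorBasis i) v
    rw [adjMatrix_mulVec_eq, hi] at this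
    simpa using this
  have hy0 : y ≠ 0 := by
    intro h
    have h1 := (isHermitian_adjMatrix G).eigenvectorBasis.orthonormal.ne_zero i
    exact h1 (by ext v; exact congrFun h v)
  have hz : ∀ v, adjSum G (fun v => |y v|) v = rho G * |y v| := by
    refine adjSum_eq_of_le (x := fun v => |y v|) ?_
    calc rho G * ∑ v, |y v| * |y v| = ∑ v, y v * adjSum G y v := by
          rw [Finset.mul_sum]
          exact Finset.sum_congr rfl fun v _ => by rw [hAy, abs_mul_abs_self]; ring
      _ ≤ _ := by
          refine Finset.sum_le_sum fun v _ => ?_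
          calc y v * adjSum G y v ≤ |y v| * |adjSum G y v| := by
                rw [← abs_mul]; exact le_abs_self _
            _ ≤ _ := by
                gcongr
                exact Finset.abs_sum_le_sum_abs _ _
  obtain ⟨m, hm⟩ := Finite.exists_max fun v => |y v|
  have hmpos : 0 < |y m| := by
    obtain ⟨v, hv⟩ := Function.ne_iff.mp hy0
    exact (abs_pos.mpr hv).trans_le (hm v)
  refine ⟨fun v => |y v| / |y m|, fun v => by positivity,
    fun v => (div_le_one hmpos).mpr (hm v), ⟨m, div_self hmpos.ne'⟩, fun v => ?_⟩
  have := hz v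
  simp only [adjSum] at this ⊢
  rw [← Finset.sum_div, this, mul_div_assoc]

lemma adjSum_mono {G H : SimpleGraph W} (hGH : G ≤ H) {x : W → ℝ} (hx : ∀ v, 0 ≤ x v) (v : W) :
    adjSum G x v ≤ adjSum H x v :=
  Finset.sum_le_sum_of_subset_of_nonneg
    (Finset.monotone_filter_right _ fun _ _ h => hGH h) fun u _ _ => hx u

/-- If `H` has a dominating vertex, proper subgraphs of `H` have a smaller spectral radius. -/
lemma eq_of_le_of_rho_le {G H : SimpleGraph W} (hGH : G ≤ H) {c : W}
    (hc : ∀ v, v ≠ c → H.Adj c v) (h : rho H ≤ rho G) : G = H := by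
  have : Nonempty W := ⟨c⟩
  obtain ⟨x, hx0, hx1, ⟨m, hm⟩, hxe⟩ := exists_perron G
  have hsum : 0 ≤ ∑ v, x v * x v := Finset.sum_nonneg fun v _ => mul_self_nonneg _
  have hle : ∑ v, x v * adjSum G x v ≤ ∑ v, x v * adjSum H x v :=
    Finset.sum_le_sum fun v _ => mul_le_mul_of_nonneg_left (adjSum_mono hGH hx0 v) (hx0 v)
  have hG : ∑ v, x v * adjSum G x v = rho G * ∑ v, x v * x v := by
    rw [Finset.mul_sum]
    exact Finset.sum_congr rfl fun v _ => by rw [hxe]; ring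
  have hHe : ∀ v, adjSum H x v = rho H * x v := adjSum_eq_of_le (by nlinarith)
  have hrho : rho G = rho H := by
    refine le_antisymm ?_ h
    have h2 := adjSum_mono hGH hx0 m
    rw [hxe, hHe, hm] at h2
    linarith
  have hpos : ∀ v, x v ≠ 0 := by
    have key : ∀ v u, H.Adj v u → x v = 0 → x u = 0 := by
      intro v u hvu hv
      have h2 := hHe v
      rw [hv, mul_zero, adjSum, Finset.sum_eq_zero_iff_of_nonneg fun u _ => hx0 u] at h2
      exact h2 u (by simpa using hvu)
    intro v hv
    have hxc : x c = 0 := by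
      by_cases hvc : v = c
      · rwa [← hvc]
      · exact key v c (hc v hvc).symm hv
    by_cases hmc : m = c
    · rw [hmc] at hm; linarith
    · have := key c m (hc m hmc) hxc; linarith
  refine le_antisymm hGH fun v u hvu => ?_
  by_contra hG'
  have h3 : adjSum G x v < adjSum H x v := by
    refine Finset.sum_lt_sum_of_subset (i := u)
      (Finset.monotone_filter_right _ fun _ _ h => hGH h) ?_ ?_ ?_ fun u _ _ => hx0 u
    · simpa using hvu
    · simpa using hG'
    · exact lt_of_le_of_ne (hx0 u) (hpos u).symm
  rw [hxe, hHe, hrho] at h3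
  exact lt_irrefl _ h3

lemma rho_congr {W' : Type*} [Fintype W'] {G : SimpleGraph W} {H : SimpleGraph W'} (e : G ≃g H) :
    rho G = rho H := by
  unfold rho
  have h := SimpleGraph.Iso.reindex_adjMatrix (α := ℝ) e
  rw [← h]
  exact congrArg sSup (AlgEquiv.spectrum_eq (Matrix.reindexAlgEquiv ℝ ℝ e.toEquiv) _).symm

/-- A graph containing the complete bipartite graph between `L` and its complement has large
spectral radius. -/
lemma card_mul_card_le_rho_sq {G : SimpleGraph W} {L : Finset W}
    (hLne : L.Nonempty) (hLlt : #L < Fintype.card W)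
    (hL : ∀ l ∈ L, ∀ r, r ∉ L → G.Adj l r) :
    0 ≤ rho G ∧ (#L : ℝ) * (Fintype.card W - #L) ≤ rho G ^ 2 := by
  have hLc : Lᶜ.Nonempty := card_pos.mp (by rw [card_compl]; omega)
  have hcard : (Fintype.card W : ℝ) - #L = #Lᶜ := by
    rw [card_compl, Nat.cast_sub hLlt.le]
  rw [hcard]
  set a : ℝ := √(#L : ℝ) with ha
  set b : ℝ := √(#Lᶜ : ℝ) with hb
  have ha2 : a * a = #L := Real.mul_self_sqrt (by positivity)
  have hb2 : b * b = #Lᶜ := Real.mul_self_sqrt (by positivity)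
  have hapos : 0 < a := Real.sqrt_pos.mpr (by exact_mod_cast hLne.card_pos)
  have hbpos : 0 < b := Real.sqrt_pos.mpr (by exact_mod_cast hLc.card_pos)
  set x : W → ℝ := fun v => if v ∈ L then b else a with hx
  have hx0 : ∀ v, 0 ≤ x v := fun v => by simp only [hx]; split_ifs <;> positivity
  have h1 : ∀ v ∈ L, b * b * a ≤ adjSum G x v := by
    intro v hv
    calc b * b * a = ∑ u ∈ Lᶜ, x u := by
          rw [Finset.sum_congr rfl fun u hu => if_neg (Finset.mem_compl.mp hu)]
          simp [hb2]
      _ ≤ _ := Finset.sum_le_sum_of_subset_of_nonneg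
          (fun u hu => by simpa using hL v hv u (Finset.mem_compl.mp hu)) fun u _ _ => hx0 u
  have h2 : ∀ v ∈ Lᶜ, a * a * b ≤ adjSum G x v := by
    intro v hv
    calc a * a * b = ∑ u ∈ L, x u := by
          rw [Finset.sum_congr rfl fun u hu => if_pos hu]
          simp [ha2]
      _ ≤ _ := Finset.sum_le_sum_of_subset_of_nonneg
          (fun u hu => by simpa using (hL u hu v (Finset.mem_compl.mp hv)).symm) fun u _ _ => hx0 u
  have h3 := sum_mul_adjSum_le G x
  rw [← Finset.sum_add_sum_compl L, ← Finset.sum_add_sum_compl L] at h3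
  have h4 : ∑ v ∈ L, x v * adjSum G x v ≥ #L * (b * (b * b * a)) := by
    rw [← nsmul_eq_mul]
    refine Finset.card_nsmul_le_sum _ _ _ fun v hv => ?_
    rw [show x v = b from if_pos hv]
    exact mul_le_mul_of_nonneg_left (h1 v hv) hbpos.le
  have h5 : ∑ v ∈ Lᶜ, x v * adjSum G x v ≥ #Lᶜ * (a * (a * a * b)) := by
    rw [← nsmul_eq_mul]
    refine Finset.card_nsmul_le_sum _ _ _ fun v hv => ?_
    rw [show x v = a from if_neg (Finset.mem_compl.mp hv)]
    exact mul_le_mul_of_nonneg_left (h2 v hv) hapos.le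
  have h6 : ∑ v ∈ L, x v * x v = #L * (b * b) := by
    rw [Finset.sum_congr rfl fun u hu => by rw [show x u = b from if_pos hu]]
    simp
  have h7 : ∑ v ∈ Lᶜ, x v * x v = #Lᶜ * (a * a) := by
    rw [Finset.sum_congr rfl fun u hu => by rw [show x u = a from if_neg (Finset.mem_compl.mp hu)]]
    simp
  rw [h6, h7] at h3
  rw [← ha2] at h3 h4
  rw [← hb2] at h3 h5
  rw [← ha2, ← hb2]
  have hab : 0 < a * b := mul_pos hapos hbpos
  have h8 : a * b ≤ rho G := by
    have h9 : (a * b) * (2 * (a * b) * (a * b)) ≤ rho G * (2 * (a * b) * (a * b)) := by nlinarith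
    exact le_of_mul_le_mul_right h9 (by positivity)
  exact ⟨hab.le.trans h8, by nlinarith⟩

end Spectral

section Embedding

universe u

variable {V : Type u} [Fintype V] {F : SimpleGraph V} {W : Type*} {G : SimpleGraph W}

/-- Greedy embedding of a tree, the vertex `v` being sent into the prescribed set `S v`. -/
theorem exists_injective_hom_of_isTree (m : ℕ) : ∀ {V : Type u} [Fintype V] {F : SimpleGraph V},
    Fintype.card V = m → F.IsTree → ∀ S : V → Finset W, (∀ v, (S v).Nonempty) →
    (∀ u v, F.Adj u v → ∀ w ∈ S u, #{z | ¬ Disjoint (S z) (S v)} ≤ #{y ∈ S v | G.Adj w y}) →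
    ∃ f : V → W, Function.Injective f ∧ (∀ u v, F.Adj u v → G.Adj (f u) (f v)) ∧
      ∀ v, f v ∈ S v := by
  induction m with
  | zero =>
    intro V _ F hV hF
    have := hF.1.nonempty
    exact absurd hV Fintype.card_ne_zero
  | succ m ih =>
    intro V _ F hV hF S hne hS
    have hVne := hF.1.nonempty
    rcases subsingleton_or_nontrivial V with hsub | hnt
    · choose f hf using hne
      exact ⟨f, Function.injective_of_subsingleton f,
        fun u v h => absurd (Subsingleton.elim u v) h.ne, hf⟩
    obtain ⟨a, ha⟩ := hF.exists_vert_degree_one_of_nontrivial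
    obtain ⟨b, hab, hb⟩ := SimpleGraph.degree_eq_one_iff_existsUnique_adj.mp ha
    have hT : (F.induce ({a}ᶜ : Set V)).IsTree :=
      ⟨hF.1.induce_compl_singleton_of_degree_eq_one ha, hF.2.induce _⟩
    obtain ⟨f, hfi, hfa, hfS⟩ := ih (F := F.induce ({a}ᶜ : Set V))
      (by rw [Fintype.card_compl_set]; simp [hV]) hT (fun z => S z) (fun z => hne z) (by
        intro u v huv w hw
        refine le_trans ?_ (hS u v huv w hw)
        exact Finset.card_le_card_of_injOn (fun z => (z : V)) (fun z hz => by simpa using hz)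
          Subtype.val_injective.injOn)
    have hba : b ∈ ({a}ᶜ : Set V) := by simpa using hab.ne'
    have hlt : #((univ.image f).filter (· ∈ S a)) < #{y ∈ S a | G.Adj (f ⟨b, hba⟩) y} := by
      refine lt_of_lt_of_le ?_ (hS b a hab.symm _ (hfS _))
      have hsub : ((univ.image f).filter (· ∈ S a)) ⊆
          (({z | ¬ Disjoint (S z) (S a)} : Finset V).erase a).image
            (fun z => if h : z ∈ ({a}ᶜ : Set V) then f ⟨z, h⟩ else f ⟨b, hba⟩) := by
        intro y hy
        simp only [mem_filter, mem_image, mem_univ, true_and] at hy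
        obtain ⟨⟨z, rfl⟩, hz⟩ := hy
        rw [mem_image]
        refine ⟨z, ?_, by rw [dif_pos z.2]⟩
        simp only [mem_erase, mem_filter, mem_univ, true_and]
        exact ⟨z.2, Finset.not_disjoint_iff.mpr ⟨_, hfS z, hz⟩⟩
      refine lt_of_le_of_lt ((card_le_card hsub).trans card_image_le) ?_
      refine card_erase_lt_of_mem ?_
      simp only [mem_filter, mem_univ, true_and]
      rw [disjoint_self]
      exact (hne a).ne_empty
    obtain ⟨y, hy, hyf⟩ : ∃ y ∈ ({y ∈ S a | G.Adj (f ⟨b, hba⟩) y} : Finset W),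
        y ∉ ((univ.image f).filter (· ∈ S a)) := by
      by_contra! hcon
      exact absurd (card_le_card hcon) (not_le.mpr hlt)
    simp only [mem_filter, mem_image, mem_univ, true_and, not_and] at hy hyf
    have hyf' : ∀ z, f z ≠ y := fun z hz => hyf ⟨z, hz⟩ hy.1
    refine ⟨fun z => if h : z ∈ ({a}ᶜ : Set V) then f ⟨z, h⟩ else y, ?_, ?_, ?_⟩
    · intro z z' hzz
      by_cases hz : z ∈ ({a}ᶜ : Set V) <;> by_cases hz' : z' ∈ ({a}ᶜ : Set V)
      · simp only [hz, hz', dif_pos] at hzz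
        exact congrArg Subtype.val (hfi hzz)
      · simp only [hz, hz', dif_pos] at hzz
        exact absurd hzz (hyf' _)
      · simp only [hz, hz', dif_pos] at hzz
        exact absurd hzz.symm (hyf' _)
      · simp only [Set.mem_compl_iff, Set.mem_singleton_iff, not_not] at hz hz'
        rw [hz, hz']
    · intro z z' hzz
      by_cases hz : z ∈ ({a}ᶜ : Set V) <;> by_cases hz' : z' ∈ ({a}ᶜ : Set V)
      · simp only [hz, hz', dif_pos]
        exact hfa _ _ hzz
      · simp only [hz, hz', dif_pos]
        simp only [Set.mem_compl_iff, Set.mem_singleton_iff, not_not] at hz'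
        subst hz'
        obtain rfl := hb z hzz.symm
        exact hy.2
      · simp only [hz, hz', dif_pos]
        simp only [Set.mem_compl_iff, Set.mem_singleton_iff, not_not] at hz
        subst hz
        obtain rfl := hb z' hzz
        exact hy.2.symm
      · simp only [Set.mem_compl_iff, Set.mem_singleton_iff, not_not] at hz hz'
        exact absurd (hz.trans hz'.symm) hzz.ne
    · intro z
      by_cases hz : z ∈ ({a}ᶜ : Set V)
      · simp only [hz, dif_pos]
        exact hfS _
      · simp only [hz]
        obtain rfl : z = a := by simpa using hz
        exact hy.1

lemma isContained_of_injective {V W : Type*} {F : SimpleGraph V} {G : SimpleGraph W} {f : V → W}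
    (hf : Function.Injective f) (h : ∀ u v, F.Adj u v → G.Adj (f u) (f v)) : F.IsContained G :=
  ⟨⟨⟨f, fun {a b} hab => h a b hab⟩, hf⟩⟩

/-- A graph without a copy of a tree is degenerate. -/
lemma exists_card_adj_lt (hF : F.IsTree) (hG : F.Free G) {U : Finset W} (hU : U.Nonempty) :
    ∃ v ∈ U, #{u ∈ U | G.Adj v u} < Fintype.card V := by
  by_contra! hcon
  obtain ⟨f, hf, hfa, -⟩ := exists_injective_hom_of_isTree (G := G) _ rfl hF (fun _ => U)
    (fun _ => hU) fun u v _ w hw => (card_le_univ _).trans (hcon w hw)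
  exact hG (isContained_of_injective hf hfa)

/-- A graph without a copy of a tree having a partite set `A` has no bipartite subgraph of large
minimum degree; on one side a minimum degree of `#A` is large enough. -/
lemma exists_card_adj_lt_or (hF : F.IsTree) (hG : F.Free G) {A : Finset V}
    (hA : ∀ u v, F.Adj u v → (u ∈ A ↔ v ∉ A)) {X Y : Finset W} (hXY : Disjoint X Y)
    (hX : X.Nonempty) (hY : Y.Nonempty) :
    (∃ x ∈ X, #{y ∈ Y | G.Adj x y} < Fintype.card V) ∨ ∃ y ∈ Y, #{x ∈ X | G.Adj y x} < #A := by
  by_contra! hcon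
  obtain ⟨hc1, hc2⟩ := hcon
  obtain ⟨f, hf, hfa, -⟩ := exists_injective_hom_of_isTree (G := G) _ rfl hF
    (fun v => if v ∈ A then X else Y) (fun v => by split_ifs <;> assumption) (by
      intro u v huv w hw
      by_cases hu : u ∈ A
      · have hv : v ∉ A := (hA u v huv).mp hu
        simp only [hu, hv, if_true, if_false] at hw ⊢
        exact (card_le_univ _).trans (hc1 w hw)
      · have hv : v ∈ A := by by_contra hv; exact hu ((hA u v huv).mpr hv)
        simp only [hu, hv, if_true, if_false] at hw ⊢
        refine (card_le_card ?_).trans (hc2 w hw)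
        intro z hz
        by_contra hzA
        simp only [mem_filter, hzA, if_false] at hz
        exact hz.2 hXY.symm)
  exact hG (isContained_of_injective hf hfa)

lemma sum_card_adj_le (hF : F.IsTree) (hG : F.Free G) (U : Finset W) :
    ∑ v ∈ U, #{u ∈ U | G.Adj v u} ≤ 2 * Fintype.card V * #U := by
  induction hn : #U generalizing U with
  | zero => rw [card_eq_zero.mp hn]; simp
  | succ m ih =>
    obtain ⟨a, haU, ha⟩ := exists_card_adj_lt hF hG (card_pos.mp (by omega : 0 < #U))
    have h1 := ih (U.erase a) (by rw [card_erase_of_mem haU]; omega)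
    rw [← insert_erase haU] at ha ⊢
    set T := U.erase a
    have haT : a ∉ T := notMem_erase _ _
    rw [sum_insert haT]
    have h2 : ∑ v ∈ T, #{u ∈ insert a T | G.Adj v u} =
        ∑ v ∈ T, #{u ∈ T | G.Adj v u} + #{v ∈ T | G.Adj a v} := by
      rw [card_filter (fun v => G.Adj a v), ← sum_add_distrib]
      refine sum_congr rfl fun v _ => ?_
      rw [filter_insert]
      by_cases hva : G.Adj v a
      · rw [if_pos hva, if_pos hva.symm, card_insert_of_notMem (by simp [haT])]
      · rw [if_neg hva, if_neg fun h => hva h.symm]; rfl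
    have h3 : #{v ∈ T | G.Adj a v} ≤ #{u ∈ insert a T | G.Adj a u} :=
      card_le_card (filter_subset_filter _ (subset_insert _ _))
    rw [h2]
    nlinarith

lemma sum_card_adj_comm (X Y : Finset W) :
    ∑ y ∈ Y, #{x ∈ X | G.Adj y x} = ∑ x ∈ X, #{y ∈ Y | G.Adj x y} := by
  simp only [card_filter]
  rw [sum_comm]
  simp only [G.adj_comm]

lemma sum_card_adj_le_of_disjoint (hF : F.IsTree) (hG : F.Free G) {A : Finset V}
    (hA : ∀ u v, F.Adj u v → (u ∈ A ↔ v ∉ A)) {k : ℕ} (hk : #A ≤ k + 1) {X Y : Finset W}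
    (hXY : Disjoint X Y) :
    ∑ y ∈ Y, #{x ∈ X | G.Adj y x} ≤ k * #Y + Fintype.card V * #X := by
  induction hn : #X + #Y generalizing X Y with
  | zero =>
    rw [card_eq_zero.mp (by omega : #Y = 0)]; simp
  | succ m ih =>
    by_cases h : ∃ y ∈ Y, #{x ∈ X | G.Adj y x} ≤ k
    · obtain ⟨y, hy, hyk⟩ := h
      have h1 := ih (disjoint_of_subset_right (erase_subset y Y) hXY)
        (by rw [card_erase_of_mem hy]; have := card_pos.mpr ⟨y, hy⟩; omega)
      rw [← add_sum_erase _ _ hy]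
      have h2 := card_erase_add_one hy
      nlinarith
    by_cases h' : ∃ x ∈ X, #{y ∈ Y | G.Adj x y} < Fintype.card V
    · obtain ⟨x, hx, hxk⟩ := h'
      have h1 := ih (disjoint_of_subset_left (erase_subset x X) hXY)
        (by rw [card_erase_of_mem hx]; have := card_pos.mpr ⟨x, hx⟩; omega)
      rw [sum_card_adj_comm] at h1 ⊢
      rw [← add_sum_erase _ _ hx]
      have h2 := card_erase_add_one hx
      nlinarith
    exfalso
    push Not at h h'
    rcases Y.eq_empty_or_nonempty with rfl | hY
    · obtain ⟨x, hx⟩ := card_pos.mp (by simp at hn; omega : 0 < #X)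
      have := h' x hx
      have := hF.1.nonempty
      simp at h'
      exact absurd (h' x hx) (by simp)
    · obtain ⟨y, hy⟩ := hY
      have hX : X.Nonempty := by
        obtain ⟨x, hx⟩ := card_pos.mp (Nat.zero_lt_of_lt (h y hy))
        exact ⟨x, (mem_filter.mp hx).1⟩
      rcases exists_card_adj_lt_or hF hG hA hXY hX ⟨y, hy⟩ with ⟨x, hx, hlt⟩ | ⟨y, hy, hlt⟩
      · exact absurd (h' x hx) (by omega)
      · exact absurd (h y hy) (by omega)

end Embedding

section Stability

variable {V : Type*} [Fintype V] {F : SimpleGraph V} {W : Type*} [Fintype W] {G : SimpleGraph W}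

/-- Bounds on degrees and codegrees from a nonnegative eigenvector of a graph without a copy of a
tree. -/
lemma degree_and_codegree_bounds (hF : F.IsTree) (hG : F.Free G) {A : Finset V}
    (hA : ∀ u v, F.Adj u v → (u ∈ A ↔ v ∉ A)) {k : ℕ} (hk : 1 ≤ k) (hAk : #A ≤ k + 1)
    {x : W → ℝ} (hx0 : ∀ v, 0 ≤ x v) (hx1 : ∀ v, x v ≤ 1) {r : ℝ} (hr : 0 < r)
    (hxe : ∀ v, adjSum G x v = r * x v) {η : ℝ} (hη : 0 < η)
    (h1 : 2 * (Fintype.card V : ℝ) ≤ η ^ 2 * r) (h2 : (k - η) * Fintype.card W ≤ r ^ 2) :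
    (∀ v, Fintype.card W * x v ≤
      6 * Fintype.card V * η * Fintype.card W + #{u | G.Adj v u}) ∧
    ∀ v, x v = 1 → ∃ c : W → ℝ, (∀ w, 0 ≤ c w ∧ c w ≤ Fintype.card W) ∧
      (k - 6 * Fintype.card V * η) * Fintype.card W ≤ ∑ w, c w * x w ∧
      ∑ w, c w ≤ (k + 6 * Fintype.card V * η) * Fintype.card W := by
  have hVne := hF.1.nonempty
  have hl1 : (1 : ℝ) ≤ Fintype.card V := by exact_mod_cast Fintype.card_pos
  have hk1 : (1 : ℝ) ≤ k := by exact_mod_cast hk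
  set l : ℝ := (Fintype.card V : ℝ) with hl
  set n : ℝ := (Fintype.card W : ℝ) with hn
  have hn0 : 0 ≤ n := by positivity
  set L : Finset W := {v | η ≤ x v} with hLdef
  have hdeg : ∑ v, (#{u | G.Adj v u} : ℝ) ≤ 2 * l * n := by
    have := sum_card_adj_le hF hG (univ : Finset W)
    rw [card_univ] at this
    rw [hl, hn]
    exact_mod_cast this
  have hL : (#L : ℝ) ≤ η * n := by
    have h3 : (#L : ℝ) * (r * η) ≤ 2 * l * n := by
      calc (#L : ℝ) * (r * η) = ∑ v ∈ L, r * η := by simp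
        _ ≤ ∑ v ∈ L, (#{u | G.Adj v u} : ℝ) := by
            refine sum_le_sum fun v hv => ?_
            calc r * η ≤ r * x v := mul_le_mul_of_nonneg_left (by simpa [hLdef] using hv) hr.le
              _ = adjSum G x v := (hxe v).symm
              _ ≤ ∑ u with G.Adj v u, 1 := sum_le_sum fun u _ => hx1 u
              _ = _ := by simp
        _ ≤ ∑ v, (#{u | G.Adj v u} : ℝ) :=
            sum_le_sum_of_subset_of_nonneg (subset_univ _) fun _ _ _ => by positivity
        _ ≤ _ := hdeg
    have h4 : (#L : ℝ) * (r * η) ≤ η * n * (r * η) := by nlinarith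
    exact le_of_mul_le_mul_right h4 (by positivity)
  have hLL : ∑ u ∈ L, (#{w ∈ L | G.Adj u w} : ℝ) ≤ 2 * l * (η * n) := by
    have := sum_card_adj_le hF hG L
    have h3 : ∑ u ∈ L, (#{w ∈ L | G.Adj u w} : ℝ) ≤ 2 * l * #L := by rw [hl]; exact_mod_cast this
    exact h3.trans (mul_le_mul_of_nonneg_left hL (by positivity))
  set Y : W → Finset W := fun v => {u | G.Adj v u ∧ u ∉ L} with hY
  set c : W → W → ℝ := fun v w => if w ∈ L then (#{u ∈ Y v | G.Adj w u} : ℝ) else 0 with hc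
  have hc0 : ∀ v w, 0 ≤ c v w := fun v w => by simp only [hc]; split_ifs <;> positivity
  have hcn : ∀ v w, c v w ≤ n := fun v w => by
    simp only [hc]
    split_ifs
    · exact Nat.cast_le.mpr (card_le_univ _)
    · exact hn0
  have hcsum : ∀ v, ∑ w, c v w ≤ k * #{u | G.Adj v u} + l * (η * n) := by
    intro v
    have hdis : Disjoint L (Y v) := by
      rw [Finset.disjoint_left]
      intro a ha ha'
      simp only [hY, mem_filter] at ha'
      exact ha'.2.2 ha
    have h3 := sum_card_adj_le_of_disjoint hF hG hA hAk hdis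
    rw [sum_card_adj_comm] at h3
    have h4 : ∑ w, c v w ≤ k * #(Y v) + l * #L := by
      simp only [hc]
      rw [← sum_filter, filter_mem_eq_inter, univ_inter]
      rw [hl]
      exact_mod_cast h3
    have h5 : (#(Y v) : ℝ) ≤ #{u | G.Adj v u} := by
      refine Nat.cast_le.mpr (card_le_card ?_)
      intro u hu
      simp only [hY, mem_filter] at hu
      simpa using hu.2.1
    have h6 : (k : ℝ) * #(Y v) ≤ k * #{u | G.Adj v u} := by gcongr
    have h7 : l * #L ≤ l * (η * n) := by gcongr
    linarith
  have hmain : ∀ v, r ^ 2 * x v ≤ 4 * l * η * n + ∑ w, c v w * x w := by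
    intro v
    have e1 : r ^ 2 * x v = ∑ u with G.Adj v u, adjSum G x u := by
      rw [sum_congr rfl fun u _ => hxe u, ← mul_sum]
      have := hxe v
      rw [adjSum] at this
      rw [this]; ring
    have e2 : ∀ u, adjSum G x u ≤ ∑ w ∈ L with G.Adj u w, x w + η * #{w | G.Adj u w} := by
      intro u
      rw [adjSum, ← sum_filter_add_sum_filter_not _ (fun w => w ∈ L)]
      refine add_le_add (le_of_eq (sum_congr ?_ fun _ _ => rfl)) ?_
      · ext w; simp [and_comm]
      · calc _ ≤ ∑ w ∈ ({w | G.Adj u w} : Finset W) with w ∉ L, η := by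
              refine sum_le_sum fun w hw => ?_
              simp only [hLdef, mem_filter, mem_univ, true_and, not_le] at hw
              exact hw.2.le
          _ ≤ ∑ w with G.Adj u w, η :=
              sum_le_sum_of_subset_of_nonneg (filter_subset _ _) fun _ _ _ => hη.le
          _ = _ := by simp [mul_comm]
    have e3 : ∑ u with G.Adj v u, η * (#{w | G.Adj u w} : ℝ) ≤ 2 * l * η * n := by
      rw [← mul_sum]
      have : ∑ u with G.Adj v u, (#{w | G.Adj u w} : ℝ) ≤ ∑ u, (#{w | G.Adj u w} : ℝ) :=
        sum_le_sum_of_subset_of_nonneg (subset_univ _) fun _ _ _ => by positivity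
      have h3 := mul_le_mul_of_nonneg_left (this.trans hdeg) hη.le
      linarith
    have e4 : ∑ u with G.Adj v u, ∑ w ∈ L with G.Adj u w, x w ≤
        2 * l * (η * n) + ∑ w, c v w * x w := by
      rw [← sum_filter_add_sum_filter_not _ (fun u => u ∈ L)]
      refine add_le_add ?_ (le_of_eq ?_)
      · refine le_trans ?_ hLL
        calc _ ≤ ∑ u ∈ ({u | G.Adj v u} : Finset W) with u ∈ L, (#{w ∈ L | G.Adj u w} : ℝ) := by
              refine sum_le_sum fun u _ => ?_
              calc _ ≤ ∑ w ∈ L with G.Adj u w, (1 : ℝ) := sum_le_sum fun w _ => hx1 w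
                _ = _ := by simp
          _ ≤ _ := by
              refine sum_le_sum_of_subset_of_nonneg ?_ fun _ _ _ => by positivity
              intro u hu
              exact (mem_filter.mp hu).2
      · have e5 : ({u ∈ ({u | G.Adj v u} : Finset W) | u ∉ L} : Finset W) = Y v := by
          ext u; simp [hY]
        rw [e5]
        simp only [hc, sum_filter, ite_mul, zero_mul]
        rw [sum_comm, ← sum_filter, filter_mem_eq_inter, univ_inter]
        refine sum_congr rfl fun w _ => ?_
        rw [← sum_filter, sum_const, nsmul_eq_mul]
        simp only [G.adj_comm]
    rw [e1]
    have := sum_le_sum fun u (_ : u ∈ ({u | G.Adj v u} : Finset W)) => e2 u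
    rw [sum_add_distrib] at this
    linarith
  have hcx : ∀ v, ∑ w, c v w * x w ≤ ∑ w, c v w := fun v =>
    sum_le_sum fun w _ => mul_le_of_le_one_right (hc0 v w) (hx1 w)
  have hηn : η * n ≤ l * (η * n) := le_mul_of_one_le_left (by positivity) hl1
  constructor
  · intro v
    have h3 := hmain v
    have h4 := hcsum v
    have h5 := hcx v
    have h6 : (k - η) * n * x v ≤ r ^ 2 * x v := mul_le_mul_of_nonneg_right h2 (hx0 v)
    have h7 : η * n * x v ≤ η * n := mul_le_of_le_one_right (by positivity) (hx1 v)
    have h8 : (k : ℝ) * (n * x v) ≤ k * (6 * l * η * n + #{u | G.Adj v u}) := by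
      have h9 : (6 * l * η * n) ≤ k * (6 * l * η * n) :=
        le_mul_of_one_le_left (by positivity) hk1
      nlinarith
    exact le_of_mul_le_mul_left h8 (by linarith)
  · intro v hv
    refine ⟨c v, fun w => ⟨hc0 v w, hcn v w⟩, ?_, ?_⟩
    · have h3 := hmain v
      rw [hv] at h3
      nlinarith
    · have h4 := hcsum v
      have h5 : (k : ℝ) * #{u | G.Adj v u} ≤ k * n := by
        gcongr
        exact Nat.cast_le.mpr (card_le_univ _)
      have h6 : 0 ≤ l * (η * n) := by positivity
      linarith

/-- Replace the neighbourhood of `v` by `M`. -/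
def rewire {W : Type*} (G : SimpleGraph W) (M : Finset W) (v : W) : SimpleGraph W :=
  SimpleGraph.fromRel fun a b => (a ≠ v ∧ b ≠ v ∧ G.Adj a b) ∨ (a = v ∧ b ∈ M)

lemma rewire_adj {W : Type*} {G : SimpleGraph W} {M : Finset W} {v : W} (hv : v ∉ M) {a b : W} :
    (rewire G M v).Adj a b ↔
      (a ≠ v ∧ b ≠ v ∧ G.Adj a b) ∨ (a = v ∧ b ∈ M) ∨ (b = v ∧ a ∈ M) := by
  simp only [rewire, SimpleGraph.fromRel_adj]
  constructor
  · rintro ⟨_, (h | h) | (h | h)⟩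
    · exact Or.inl h
    · exact Or.inr (Or.inl h)
    · exact Or.inl ⟨h.2.1, h.1, h.2.2.symm⟩
    · exact Or.inr (Or.inr h)
  · rintro (h | h | h)
    · exact ⟨h.2.2.ne, Or.inl (Or.inl h)⟩
    · exact ⟨fun hab => hv (h.1 ▸ hab ▸ h.2), Or.inl (Or.inr h)⟩
    · exact ⟨fun hab => hv (h.1 ▸ hab ▸ h.2), Or.inr (Or.inr h)⟩

lemma rewire_free (hG : F.Free G) {M : Finset W} {v : W} (hv : v ∉ M)
    (hM : Fintype.card V < #{w | ∀ m ∈ M, G.Adj m w}) : F.Free (rewire G M v) := by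
  rintro ⟨f⟩
  have hfadj : ∀ a b, F.Adj a b → (rewire G M v).Adj (f a) (f b) := fun a b h => f.toHom.map_rel h
  by_cases hz : ∃ z, f z = v
  · obtain ⟨z, hz⟩ := hz
    obtain ⟨w, hw, hwf⟩ : ∃ w ∈ ({w | ∀ m ∈ M, G.Adj m w} : Finset W), w ∉ univ.image f := by
      by_contra! hcon
      have := (card_le_card hcon).trans card_image_le
      rw [card_univ] at this
      omega
    simp only [mem_filter, mem_univ, true_and, mem_image, not_exists] at hw hwf
    refine hG (isContained_of_injective (f := Function.update f z w) ?_ ?_)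
    · intro a b hab
      by_cases ha : a = z <;> by_cases hb : b = z
      · rw [ha, hb]
      · rw [ha, Function.update_self, Function.update_of_ne hb] at hab
        exact absurd hab.symm (hwf b)
      · rw [hb, Function.update_self, Function.update_of_ne ha] at hab
        exact absurd hab (hwf a)
      · rw [Function.update_of_ne ha, Function.update_of_ne hb] at hab
        exact f.injective hab
    · intro a b hab
      have hne : ∀ c, c ≠ z → f c ≠ v := fun c hc h => hc (f.injective (h.trans hz.symm))
      have h := (rewire_adj hv).mp (hfadj a b hab)
      by_cases ha : a = z <;> by_cases hb : b = z
      · exact absurd (ha.trans hb.symm) hab.ne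
      · rw [ha, Function.update_self, Function.update_of_ne hb]
        rw [ha, hz] at h
        have := hne b hb
        exact (hw _ (by tauto)).symm
      · rw [hb, Function.update_self, Function.update_of_ne ha]
        rw [hb, hz] at h
        have := hne a ha
        exact hw _ (by tauto)
      · rw [Function.update_of_ne ha, Function.update_of_ne hb]
        have := hne a ha
        have := hne b hb
        tauto
  · refine hG (isContained_of_injective f.injective fun a b hab => ?_)
    have h := (rewire_adj hv).mp (hfadj a b hab)
    have h1 : f a ≠ v := fun h => hz ⟨a, h⟩
    have h2 : f b ≠ v := fun h => hz ⟨b, h⟩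
    tauto

lemma adjSum_rewire_self {M : Finset W} {v : W} (hv : v ∉ M) (x : W → ℝ) :
    adjSum (rewire G M v) x v = ∑ m ∈ M, x m := by
  refine sum_congr ?_ fun _ _ => rfl
  ext u
  rw [mem_filter, rewire_adj hv]
  constructor
  · rintro ⟨-, h | h | h⟩
    · exact absurd rfl h.1
    · exact h.2
    · exact absurd h.2 hv
  · exact fun h => ⟨mem_univ _, Or.inr (Or.inl ⟨rfl, h⟩)⟩

lemma adjSum_rewire_of_ne {M : Finset W} {v : W} (hv : v ∉ M) (x : W → ℝ) {a : W} (ha : a ≠ v) :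
    adjSum (rewire G M v) x a =
      adjSum G x a - (if G.Adj v a then x v else 0) + (if a ∈ M then x v else 0) := by
  simp only [adjSum, sum_filter]
  rw [← add_sum_erase _ _ (mem_univ v),
    ← add_sum_erase (univ : Finset W) (fun u => if G.Adj a u then x u else 0) (mem_univ v)]
  have h1 : (rewire G M v).Adj a v ↔ a ∈ M := by
    rw [rewire_adj hv]; tauto
  have h2 : ∑ u ∈ univ.erase v, (if (rewire G M v).Adj a u then x u else 0) =
      ∑ u ∈ univ.erase v, (if G.Adj a u then x u else 0) := by
    refine sum_congr rfl fun u hu => ?_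
    have hu' : u ≠ v := (mem_erase.mp hu).1
    have : (rewire G M v).Adj a u ↔ G.Adj a u := by rw [rewire_adj hv]; tauto
    simp only [this]
  rw [h2]
  simp only [h1, G.adj_comm a v]
  ring

/-- Moving the edges at `v` to heavier neighbours increases the spectral radius. -/
lemma rho_lt_rho_rewire {M : Finset W} {v : W} (hv : v ∉ M) {x : W → ℝ} (hx0 : ∀ v, 0 ≤ x v)
    (hxe : ∀ v, adjSum G x v = rho G * x v) (hxne : ∃ u, x u = 1)
    (hlt : adjSum G x v < ∑ m ∈ M, x m) : rho G < rho (rewire G M v) := by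
  by_contra! hle
  have hsum : ∑ a, x a * adjSum (rewire G M v) x a =
      ∑ a, x a * adjSum G x a + 2 * x v * (∑ m ∈ M, x m - adjSum G x v) := by
    rw [← add_sum_erase _ _ (mem_univ v),
      ← add_sum_erase (univ : Finset W) (fun a => x a * adjSum G x a) (mem_univ v),
      adjSum_rewire_self hv]
    have h1 : ∑ a ∈ univ.erase v, x a * adjSum (rewire G M v) x a =
        ∑ a ∈ univ.erase v, x a * adjSum G x a
          - ∑ a ∈ univ.erase v, (if G.Adj v a then x a * x v else 0)
          + ∑ a ∈ univ.erase v, (if a ∈ M then x a * x v else 0) := by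
      rw [← sum_sub_distrib, ← sum_add_distrib]
      refine sum_congr rfl fun a ha => ?_
      rw [adjSum_rewire_of_ne hv x (mem_erase.mp ha).1]
      split_ifs <;> ring
    have h2 : ∑ a ∈ univ.erase v, (if G.Adj v a then x a * x v else 0) = x v * adjSum G x v := by
      rw [sum_erase _ (by simp), ← sum_filter, adjSum, mul_sum]
      exact sum_congr rfl fun _ _ => mul_comm _ _
    have h3 : ∑ a ∈ univ.erase v, (if a ∈ M then x a * x v else 0) = x v * ∑ m ∈ M, x m := by
      rw [sum_erase _ (by simp [hv]), ← sum_filter, filter_mem_eq_inter, univ_inter, mul_sum]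
      exact sum_congr rfl fun _ _ => mul_comm _ _
    rw [h1, h2, h3]
    ring
  have hG : ∑ a, x a * adjSum G x a = rho G * ∑ a, x a * x a := by
    rw [mul_sum]
    exact sum_congr rfl fun a _ => by rw [hxe]; ring
  have hpos : 0 < ∑ a, x a * x a := by
    obtain ⟨u, hu⟩ := hxne
    refine sum_pos' (fun a _ => mul_self_nonneg _) ⟨u, mem_univ _, by rw [hu]; norm_num⟩
  have hnn : 0 ≤ 2 * x v * (∑ m ∈ M, x m - adjSum G x v) :=
    mul_nonneg (mul_nonneg zero_le_two (hx0 v)) (by linarith)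
  have hR := sum_mul_adjSum_le (rewire G M v) x
  have heq : rho (rewire G M v) = rho G := by
    refine le_antisymm hle (le_of_mul_le_mul_right ?_ hpos)
    linarith
  have he := adjSum_eq_of_le (G := rewire G M v) (x := x) (by rw [heq]; linarith) v
  rw [adjSum_rewire_self hv, heq, ← hxe] at he
  linarith

end Stability

section Structure

variable {V : Type*} [Fintype V] {F : SimpleGraph V} {W : Type*} [Fintype W] {G : SimpleGraph W}

/-- The common neighbourhood of `#A` vertices is small in a graph without a copy of a tree having
`A` as a partite set. -/
lemma card_common_adj_lt (hF : F.IsTree) (hG : F.Free G) {A : Finset V}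
    (hA : ∀ u v, F.Adj u v → (u ∈ A ↔ v ∉ A)) {T : Finset W} (hT : T.Nonempty) (hAT : #A ≤ #T) :
    #{v | ∀ m ∈ T, G.Adj m v} < Fintype.card V := by
  by_contra! hcon
  have hVne := hF.1.nonempty
  have hdis : Disjoint T ({v | ∀ m ∈ T, G.Adj m v} : Finset W) := by
    rw [Finset.disjoint_left]
    intro a ha ha'
    exact G.loopless.irrefl a ((mem_filter.mp ha').2 a ha)
  rcases exists_card_adj_lt_or hF hG hA hdis hT
    (card_pos.mp (Fintype.card_pos.trans_le hcon)) with ⟨x, hx, hlt⟩ | ⟨y, hy, hlt⟩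
  · rw [filter_true_of_mem (p := fun y => G.Adj x y) (s := {v | ∀ m ∈ T, G.Adj m v})
      fun y hy => (mem_filter.mp hy).2 x hx] at hlt
    omega
  · rw [filter_true_of_mem (p := fun x => G.Adj y x)
      fun x hx => ((mem_filter.mp hy).2 x hx).symm] at hlt
    omega

lemma card_not_common_adj_le {T : Finset W} {δ : ℝ}
    (hT : ∀ w ∈ T, (Fintype.card W : ℝ) - δ ≤ #{u | G.Adj w u}) :
    (#({v | ∀ m ∈ T, G.Adj m v} : Finset W)ᶜ : ℝ) ≤ #T * δ := by
  have hsub : ({v | ∀ m ∈ T, G.Adj m v} : Finset W)ᶜ ⊆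
      T.biUnion fun w => ({u | G.Adj w u} : Finset W)ᶜ := by
    intro v hv
    simp only [mem_compl, mem_filter, mem_univ, true_and, not_forall] at hv
    obtain ⟨m, hm, hmv⟩ := hv
    simp only [mem_biUnion, mem_compl, mem_filter, mem_univ, true_and]
    exact ⟨m, hm, hmv⟩
  calc (#({v | ∀ m ∈ T, G.Adj m v} : Finset W)ᶜ : ℝ)
      ≤ ∑ w ∈ T, (#({u | G.Adj w u} : Finset W)ᶜ : ℝ) := by
        exact_mod_cast (card_le_card hsub).trans card_biUnion_le
    _ ≤ ∑ w ∈ T, δ := by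
        refine sum_le_sum fun w hw => ?_
        have := hT w hw
        rw [card_compl, Nat.cast_sub (card_le_univ _)]
        linarith
    _ = _ := by simp

lemma le_card_heavy {x c : W → ℝ} (hx1 : ∀ v, x v ≤ 1) {n θ ε : ℝ} (hn : 0 < n)
    (hθ : 0 < θ) (hθε : ε * θ + 2 * ε < θ) (hc : ∀ w, 0 ≤ c w ∧ c w ≤ n) {k : ℕ}
    (h1 : (k - ε) * n ≤ ∑ w, c w * x w) (h2 : ∑ w, c w ≤ (k + ε) * n) :
    k ≤ #{w | 1 - θ ≤ x w} := by
  set M : Finset W := {w | 1 - θ ≤ x w} with hM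
  have h3 : θ * ∑ w ∈ Mᶜ, c w ≤ 2 * ε * n := by
    calc θ * ∑ w ∈ Mᶜ, c w ≤ ∑ w ∈ Mᶜ, c w * (1 - x w) := by
          rw [mul_sum]
          refine sum_le_sum fun w hw => ?_
          simp only [hM, mem_compl, mem_filter, mem_univ, true_and, not_le] at hw
          rw [mul_comm]
          exact mul_le_mul_of_nonneg_left (by linarith) (hc w).1
      _ ≤ ∑ w, c w * (1 - x w) :=
          sum_le_sum_of_subset_of_nonneg (subset_univ _) fun w _ _ =>
            mul_nonneg (hc w).1 (by linarith [hx1 w])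
      _ = ∑ w, c w - ∑ w, c w * x w := by
          rw [← sum_sub_distrib]
          exact sum_congr rfl fun _ _ => by ring
      _ ≤ _ := by linarith
  have h4 : ∑ w, c w * x w ≤ #M * n + ∑ w ∈ Mᶜ, c w := by
    rw [← sum_add_sum_compl M]
    refine add_le_add ?_ (sum_le_sum fun w _ => mul_le_of_le_one_right (hc w).1 (hx1 w))
    rw [← nsmul_eq_mul]
    exact sum_le_card_nsmul _ _ _ fun w _ =>
      (mul_le_of_le_one_right (hc w).1 (hx1 w)).trans (hc w).2
  have h5 : θ * ((k - ε) * n) ≤ θ * (#M * n) + 2 * ε * n := by nlinarith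
  have h6 : (θ * (k - ε)) * n ≤ (θ * #M + 2 * ε) * n := by linarith
  have h7 := le_of_mul_le_mul_right h6 hn
  have h8 : θ * k < θ * (#M + 1) := by nlinarith
  have h9 := lt_of_mul_lt_mul_left h8 hθ.le
  have h10 : k < #M + 1 := by exact_mod_cast h9
  omega

/-- If the heavy vertices of an extremal graph are at least `k` in number, they are exactly `k` and
adjacent to all other vertices. -/
lemma complete_split_of_heavy (hF : F.IsTree) (hG : F.Free G) {A : Finset V}
    (hA : ∀ u v, F.Adj u v → (u ∈ A ↔ v ∉ A)) {k : ℕ} (hk : 1 ≤ k) (hAk : #A ≤ k + 1)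
    (hkl : k + 1 ≤ Fintype.card V)
    (hmax : ∀ G' : SimpleGraph W, F.Free G' → rho G' ≤ rho G)
    {x : W → ℝ} (hx0 : ∀ v, 0 ≤ x v) (hxmax : ∃ v, x v = 1)
    (hxe : ∀ v, adjSum G x v = rho G * x v) {θ ε : ℝ} (hθ : 0 < θ) (hε : 0 < ε)
    (hθ2 : θ ≤ 1 / 2) (hε2 : 32 * Fintype.card V * ε ≤ 1)
    (hγ : 16 * (Fintype.card V : ℝ) ^ 2 * (θ + ε) ≤ 1)
    (hn : 32 * (Fintype.card V : ℝ) ^ 2 ≤ Fintype.card W)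
    (hdeg : ∀ v, Fintype.card W * x v ≤ ε * Fintype.card W + #{u | G.Adj v u})
    (hM : k ≤ #{w | 1 - θ ≤ x w}) :
    ∃ M : Finset W, #M = k ∧ ∀ m ∈ M, ∀ v, v ∉ M → G.Adj m v := by
  have hVne := hF.1.nonempty
  set M : Finset W := {w | 1 - θ ≤ x w} with hMdef
  have hl2 : (2 : ℝ) ≤ Fintype.card V := by exact_mod_cast (by omega : 2 ≤ Fintype.card V)
  have hkl' : (k : ℝ) + 1 ≤ Fintype.card V := by exact_mod_cast hkl
  set l : ℝ := (Fintype.card V : ℝ) with hl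
  set n : ℝ := (Fintype.card W : ℝ) with hndef
  have hnpos : 0 < n := by nlinarith
  have hln : 32 * l ≤ n := by nlinarith
  have hlγ : l * (θ + ε) ≤ 1 / 2 := by nlinarith
  have hMdeg : ∀ w ∈ M, n - (θ + ε) * n ≤ #{u | G.Adj w u} := by
    intro w hw
    have h1 : 1 - θ ≤ x w := by simpa [hMdef] using hw
    have h2 := hdeg w
    nlinarith
  have hcard : ∀ s : Finset W, (#sᶜ : ℝ) = n - #s := fun s => by
    rw [card_compl, Nat.cast_sub (card_le_univ _)]
  have hcommon : ∀ T ⊆ M, #T ≤ k + 1 → n / 2 ≤ #{v | ∀ m ∈ T, G.Adj m v} := by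
    intro T hTM hT
    have h1 := card_not_common_adj_le (T := T) fun w hw => hMdeg w (hTM hw)
    rw [hcard] at h1
    have h2 : (#T : ℝ) ≤ l := le_trans (by exact_mod_cast hT) hkl'
    have h3 : (#T : ℝ) * ((θ + ε) * n) ≤ l * ((θ + ε) * n) :=
      mul_le_mul_of_nonneg_right h2 (by positivity)
    nlinarith
  have hMk : #M = k := by
    refine le_antisymm ?_ hM
    by_contra! hlt
    obtain ⟨T, hTM, hT⟩ := exists_subset_card_eq (by omega : k + 1 ≤ #M)
    have h1 := hcommon T hTM hT.le
    have h2 := card_common_adj_lt hF hG hA (card_pos.mp (by omega : 0 < #T)) (by omega : #A ≤ #T)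
    have h3 : (#{v | ∀ m ∈ T, G.Adj m v} : ℝ) < l := by rw [hl]; exact_mod_cast h2
    linarith
  refine ⟨M, hMk, ?_⟩
  set C : Finset W := {w | ∀ m ∈ M, G.Adj m w} with hC
  have hCc : (#Cᶜ : ℝ) ≤ k * ((θ + ε) * n) := by
    rw [← hMk]
    exact card_not_common_adj_le hMdeg
  have hCl : Fintype.card V < #C := by
    have h1 := hcommon M subset_rfl (by omega)
    have h2 : l < #C := by linarith
    rw [hl] at h2
    exact_mod_cast h2
  have hCadj : ∀ v, v ∉ M → #{u ∈ C | G.Adj v u} < Fintype.card V := by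
    intro v hv
    have h1 := card_common_adj_lt hF hG hA (insert_nonempty v M)
      (by rw [card_insert_of_notMem hv]; omega)
    refine lt_of_le_of_lt (card_le_card fun u hu => ?_) h1
    simp only [hC, mem_filter, mem_univ, true_and, forall_mem_insert] at hu ⊢
    exact ⟨hu.2, hu.1⟩
  have hxsmall : ∀ v, v ∉ M → 8 * l * x v ≤ 1 := by
    intro v hv
    have h1 : (#{u | G.Adj v u} : ℝ) ≤ l + k * ((θ + ε) * n) := by
      have h2 : #{u | G.Adj v u} ≤ #{u ∈ C | G.Adj v u} + #Cᶜ := by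
        refine le_trans (card_le_card fun u hu => ?_) (card_union_le _ _)
        simp only [mem_union, mem_filter, mem_compl, mem_univ, true_and] at hu ⊢
        tauto
      have h3 : (#{u | G.Adj v u} : ℝ) ≤ #{u ∈ C | G.Adj v u} + #Cᶜ := by exact_mod_cast h2
      have h4 : (#{u ∈ C | G.Adj v u} : ℝ) ≤ l := by
        rw [hl]; exact_mod_cast (hCadj v hv).le
      linarith
    have h2 := hdeg v
    have h3 : 16 * l * (k * (θ + ε)) ≤ 1 := by
      have : (k : ℝ) * (θ + ε) ≤ l * (θ + ε) :=
        mul_le_mul_of_nonneg_right (by linarith) (by positivity)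
      nlinarith
    have h4 : 32 * l * (n * x v) ≤ 32 * l * (ε * n + (l + k * ((θ + ε) * n))) :=
      mul_le_mul_of_nonneg_left (by linarith) (by positivity)
    have h5 : (32 * l * x v) * n ≤ 4 * n := by nlinarith
    have h6 := le_of_mul_le_mul_right h5 hnpos
    linarith
  by_contra! hcon
  obtain ⟨m₀, hm₀, v₀, hv₀M, hv₀⟩ := hcon
  set E : Finset W := {v | v ∉ M ∧ v ∉ C} with hE
  have hEne : E.Nonempty := by
    refine ⟨v₀, ?_⟩
    simp only [hE, hC, mem_filter, mem_univ, true_and, not_forall]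
    exact ⟨hv₀M, m₀, hm₀, hv₀⟩
  obtain ⟨v, hvE, hvlt⟩ := exists_card_adj_lt hF hG hEne
  have hv := (mem_filter.mp hvE).2
  obtain ⟨hvM, hvC⟩ := hv
  obtain ⟨m, hmM, hmv⟩ : ∃ m ∈ M, ¬ G.Adj m v := by
    simpa [hC] using hvC
  have hrest : ∑ u ∈ ({u | G.Adj v u} : Finset W) with u ∉ M, x u ≤ 1 / 4 := by
    have h1 : #({u ∈ ({u | G.Adj v u} : Finset W) | u ∉ M} : Finset W) ≤ 2 * Fintype.card V := by
      refine (card_le_card (t := {u ∈ E | G.Adj v u} ∪ {u ∈ C | G.Adj v u}) fun u hu => ?_).trans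
        ((card_union_le _ _).trans ?_)
      · simp only [hE, mem_union, mem_filter, mem_univ, true_and] at hu ⊢
        tauto
      · have := hCadj v hvM
        omega
    have h1' : (#({u ∈ ({u | G.Adj v u} : Finset W) | u ∉ M} : Finset W) : ℝ) ≤ 2 * l := by
      rw [hl]; exact_mod_cast h1
    have h2 : ∑ u ∈ ({u | G.Adj v u} : Finset W) with u ∉ M, 8 * l * x u ≤ 2 * l := by
      calc _ ≤ ∑ u ∈ ({u | G.Adj v u} : Finset W) with u ∉ M, (1 : ℝ) :=
            sum_le_sum fun u hu => hxsmall u (mem_filter.mp hu).2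
        _ ≤ _ := by simpa using h1'
    rw [← mul_sum] at h2
    nlinarith
  have hheavy : adjSum G x v < ∑ u ∈ M, x u := by
    rw [adjSum, ← sum_filter_add_sum_filter_not _ (fun u => u ∈ M)]
    have h1 : ∑ u ∈ ({u | G.Adj v u} : Finset W) with u ∈ M, x u ≤ ∑ u ∈ M.erase m, x u := by
      refine sum_le_sum_of_subset_of_nonneg (fun u hu => ?_) fun u _ _ => hx0 u
      simp only [mem_filter, mem_univ, true_and] at hu
      rw [mem_erase]
      exact ⟨fun h => hmv (h ▸ hu.1.symm), hu.2⟩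
    have h2 : 1 - θ ≤ x m := by simpa [hMdef] using hmM
    rw [← add_sum_erase _ _ hmM]
    linarith
  exact absurd (hmax _ (rewire_free hG hvM hCl))
    (not_le.mpr (rho_lt_rho_rewire hvM hx0 hxe hxmax hheavy))

/-- An extremal graph of large order for a tree with a partite set of size at most `k + 1` contains
a spanning complete bipartite graph with a part of size `k`. -/
theorem exists_complete_split {k l : ℕ} (hk : 1 ≤ k) (hkl : k + 1 ≤ l) :
    ∃ N : ℕ, ∀ (V : Type*) [Fintype V] (F : SimpleGraph V) (W : Type*) [Fintype W]
      (G : SimpleGraph W) (A : Finset V), Fintype.card V = l → N ≤ Fintype.card W → F.IsTree →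
      F.Free G → (∀ u v, F.Adj u v → (u ∈ A ↔ v ∉ A)) → #A ≤ k + 1 →
      (∀ G' : SimpleGraph W, F.Free G' → rho G' ≤ rho G) → 0 ≤ rho G →
      (k : ℝ) * (Fintype.card W - k) ≤ rho G ^ 2 →
      ∃ M : Finset W, #M = k ∧ ∀ m ∈ M, ∀ v, v ∉ M → G.Adj m v := by
  have hl2 : (2 : ℝ) ≤ l := by exact_mod_cast (by omega : 2 ≤ l)
  have hk1 : (1 : ℝ) ≤ k := by exact_mod_cast hk
  obtain ⟨θ, hθdef⟩ : ∃ θ : ℝ, θ = 1 / (32 * l ^ 2) := ⟨_, rfl⟩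
  have hθ : 0 < θ := by rw [hθdef]; positivity
  have hθl : 32 * (l : ℝ) ^ 2 * θ = 1 := by rw [hθdef]; field_simp
  obtain ⟨ε, hεdef⟩ : ∃ ε : ℝ, ε = θ ^ 2 / 4 := ⟨_, rfl⟩
  have hε : 0 < ε := by rw [hεdef]; positivity
  have hl4 : 2 * (l : ℝ) ≤ l ^ 2 := by nlinarith
  have hlθ : 2 * (l : ℝ) * θ ≤ l ^ 2 * θ := mul_le_mul_of_nonneg_right hl4 hθ.le
  have hθ1 : θ ≤ 1 / 128 := by nlinarith [mul_le_mul_of_nonneg_right hl2 hθ.le]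
  have hεθ : ε ≤ θ / 4 := by rw [hεdef]; nlinarith
  obtain ⟨η, hηdef⟩ : ∃ η : ℝ, η = ε / (6 * l) := ⟨_, rfl⟩
  have hη : 0 < η := by rw [hηdef]; positivity
  have hηε : 6 * (l : ℝ) * η = ε := by rw [hηdef]; field_simp
  have hη1 : η ≤ 1 / 2 := by nlinarith
  obtain ⟨N₁, hN₁⟩ := exists_nat_ge ((k : ℝ) ^ 2 / η)
  obtain ⟨N₂, hN₂⟩ := exists_nat_ge (2 * (2 * l / η ^ 2) ^ 2)
  refine ⟨max (max N₁ N₂) (32 * l ^ 2), ?_⟩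
  intro V _ F W _ G A hV hW hF hG hA hAk hmax hr0 hr
  have hW1 : (N₁ : ℝ) ≤ Fintype.card W := by
    exact_mod_cast (le_max_left _ _).trans ((le_max_left _ _).trans hW)
  have hW2 : (N₂ : ℝ) ≤ Fintype.card W := by
    exact_mod_cast (le_max_right _ _).trans ((le_max_left _ _).trans hW)
  have hW3 : 32 * (l : ℝ) ^ 2 ≤ Fintype.card W := by
    exact_mod_cast (le_max_right _ _).trans hW
  have hn : (0 : ℝ) < Fintype.card W := by nlinarith
  have hne : Nonempty W := Fintype.card_pos_iff.mp (by exact_mod_cast hn)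
  have h2 : (k - η) * Fintype.card W ≤ rho G ^ 2 := by
    have := (div_le_iff₀ hη).mp (hN₁.trans hW1)
    nlinarith
  have hr2 : (2 * l / η ^ 2) ^ 2 ≤ rho G ^ 2 := by
    have := hN₂.trans hW2
    nlinarith
  have h1 : 2 * (l : ℝ) ≤ η ^ 2 * rho G := by
    have := (div_le_iff₀ (by positivity : (0 : ℝ) < η ^ 2)).mp
      ((le_abs_self _).trans (abs_le_of_sq_le_sq hr2 hr0))
    linarith
  have hrpos : 0 < rho G := by
    by_contra! h
    nlinarith [mul_nonneg (sq_nonneg η) (neg_nonneg.mpr h)]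
  obtain ⟨x, hx0, hx1, ⟨u, hu⟩, hxe⟩ := exists_perron G
  obtain ⟨hd, hc⟩ := degree_and_codegree_bounds hF hG hA hk hAk hx0 hx1 hrpos hxe hη
    (by rw [hV]; exact h1) h2
  rw [hV, hηε] at hd hc
  obtain ⟨c, hc0, hc1, hc2⟩ := hc u hu
  refine complete_split_of_heavy hF hG hA hk hAk (by omega) hmax hx0 ⟨u, hu⟩ hxe hθ hε (by linarith)
    ?_ ?_ (by rw [hV]; exact hW3) hd (le_card_heavy hx1 hn hθ ?_ hc0 hc1 hc2)
  · rw [hV]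
    have := mul_le_mul_of_nonneg_left hεθ (by positivity : (0 : ℝ) ≤ l)
    linarith
  · rw [hV]
    have := mul_le_mul_of_nonneg_left hεθ (by positivity : (0 : ℝ) ≤ (l : ℝ) ^ 2)
    linarith
  · rw [hεdef]; nlinarith

end Structure

section SplitEmbedding

variable {V : Type*} [Fintype V] {F : SimpleGraph V} {W : Type*} [Fintype W] {G : SimpleGraph W}

lemma exists_injOn_mapsTo {V W : Type*} {s : Finset V} {t : Finset W} [Nonempty W] (h : #s ≤ #t) :
    ∃ f : V → W, Set.InjOn f s ∧ ∀ v ∈ s, f v ∈ t := by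
  obtain ⟨e⟩ : Nonempty (s ↪ t) := Function.Embedding.nonempty_of_card_le (by simpa using h)
  refine ⟨fun v => if hv : v ∈ s then e ⟨v, hv⟩ else Classical.arbitrary W, ?_, ?_⟩
  · intro a ha b hb hab
    simp only [mem_coe] at ha hb
    simp only [ha, hb, dif_pos] at hab
    exact congrArg Subtype.val (e.injective (Subtype.ext hab))
  · intro v hv
    simp only [hv, dif_pos]
    exact (e _).2

/-- Embedding `F` into a graph containing all edges between `L` and its complement: the vertices
in `C` go to `L`, and the edges avoiding `C` are mapped by `g`. -/
lemma isContained_of_split {L : Finset W} {C D : Finset V} {g : V → W}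
    (hLR : ∀ l ∈ L, ∀ r, r ∉ L → G.Adj l r) (hCL : #C ≤ #L)
    (hC : ∀ u ∈ C, ∀ v ∈ C, F.Adj u v → ∀ l ∈ L, ∀ l' ∈ L, l ≠ l' → G.Adj l l')
    (hCD : Disjoint C D) (hgi : Set.InjOn g D) (hgL : ∀ d ∈ D, g d ∉ L)
    (hD : ∀ u v, u ∉ C → v ∉ C → F.Adj u v → u ∈ D ∧ v ∈ D ∧ G.Adj (g u) (g v))
    (hcard : Fintype.card V + #L ≤ Fintype.card W) : F.IsContained G := by
  rcases isEmpty_or_nonempty V with hV | hV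
  · exact isContained_of_injective (f := fun v => (hV.false v).elim) (fun v => (hV.false v).elim)
      fun v => (hV.false v).elim
  have hW : Nonempty W := Fintype.card_pos_iff.mp (by have := Fintype.card_pos (α := V); omega)
  obtain ⟨f₁, hf₁, hf₁L⟩ := exists_injOn_mapsTo hCL
  have hcard2 : #(C ∪ D)ᶜ ≤ #(L ∪ D.image g)ᶜ := by
    rw [card_compl, card_compl, card_union_of_disjoint hCD, card_union_of_disjoint,
      card_image_of_injOn hgi]
    · omega
    · rw [Finset.disjoint_right]
      intro w hw
      obtain ⟨d, hd, rfl⟩ := mem_image.mp hw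
      exact hgL d hd
  obtain ⟨f₂, hf₂, hf₂L⟩ := exists_injOn_mapsTo hcard2
  have hf₂' : ∀ v, v ∉ C → v ∉ D → f₂ v ∉ L ∧ ∀ d ∈ D, g d ≠ f₂ v := by
    intro v hvC hvD
    have := hf₂L v (by simp [hvC, hvD])
    simp only [mem_compl, mem_union, mem_image, not_or, not_exists, not_and] at this
    exact this
  have hCD' : ∀ v ∈ C, v ∉ D := fun v hv hv' => Finset.disjoint_left.mp hCD hv hv'
  set f : V → W := fun v => if v ∈ C then f₁ v else if v ∈ D then g v else f₂ v with hf
  have hfC : ∀ v ∈ C, f v = f₁ v := fun v hv => if_pos hv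
  have hfD : ∀ v, v ∉ C → v ∈ D → f v = g v := fun v hv hv' => by simp [hf, hv, hv']
  have hfE : ∀ v, v ∉ C → v ∉ D → f v = f₂ v := fun v hv hv' => by simp [hf, hv, hv']
  have hmem : ∀ v, f v ∈ L ↔ v ∈ C := by
    intro v
    by_cases hv : v ∈ C
    · simp [hfC v hv, hf₁L v hv, hv]
    by_cases hv' : v ∈ D
    · simp [hfD v hv hv', hgL v hv', hv]
    · simp [hfE v hv hv', (hf₂' v hv hv').1, hv]
  refine isContained_of_injective (f := f) ?_ ?_
  · intro a b hab
    by_cases ha : a ∈ C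
    · have hb : b ∈ C := by rw [← hmem, ← hab, hmem]; exact ha
      rw [hfC a ha, hfC b hb] at hab
      exact hf₁ ha hb hab
    have hb : b ∉ C := by rw [← hmem, ← hab, hmem]; exact ha
    by_cases ha' : a ∈ D <;> by_cases hb' : b ∈ D
    · rw [hfD a ha ha', hfD b hb hb'] at hab
      exact hgi ha' hb' hab
    · rw [hfD a ha ha', hfE b hb hb'] at hab
      exact absurd hab ((hf₂' b hb hb').2 a ha')
    · rw [hfE a ha ha', hfD b hb hb'] at hab
      exact absurd hab.symm ((hf₂' a ha ha').2 b hb')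
    · rw [hfE a ha ha', hfE b hb hb'] at hab
      exact hf₂ (by simp [ha, ha']) (by simp [hb, hb']) hab
  · intro a b hab
    by_cases ha : a ∈ C <;> by_cases hb : b ∈ C
    · refine hC a ha b hb hab _ ((hmem a).mpr ha) _ ((hmem b).mpr hb) ?_
      rw [hfC a ha, hfC b hb]
      exact fun h => hab.ne (hf₁ ha hb h)
    · exact hLR _ ((hmem a).mpr ha) _ (mt (hmem b).mp hb)
    · exact (hLR _ ((hmem b).mpr hb) _ (mt (hmem a).mp ha)).symm
    · obtain ⟨haD, hbD, h⟩ := hD a b ha hb hab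
      rwa [hfD a ha haD, hfD b hb hbD]

end SplitEmbedding

section TargetGraph

variable {n k p : ℕ}

/-- The clique part of `S n k p`. -/
def cliquePart (n k : ℕ) : Finset (Fin n) := univ.filter fun i => i.val < k

lemma mem_cliquePart {i : Fin n} : i ∈ cliquePart n k ↔ i.val < k := by simp [cliquePart]

lemma card_cliquePart (h : k ≤ n) : #(cliquePart n k) = k := by
  have : cliquePart n k = (univ : Finset (Fin k)).map (Fin.castLEEmb h) := by
    ext i
    simp only [mem_cliquePart, mem_map, mem_univ, true_and]
    exact ⟨fun hi => ⟨⟨i, hi⟩, rfl⟩, fun ⟨j, hj⟩ => by rw [← hj]; exact j.2⟩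
  rw [this, card_map, card_univ, Fintype.card_fin]

lemma S_adj_of_lt {i j : Fin n} (hi : i.val < k) (hij : i ≠ j) : (S n k p).Adj i j := by
  rw [S, SimpleGraph.fromRel_adj]
  exact ⟨hij, Or.inl (Or.inl hi)⟩

lemma S_split (l : Fin n) (hl : l ∈ cliquePart n k) (r : Fin n) (hr : r ∉ cliquePart n k) :
    (S n k p).Adj l r :=
  S_adj_of_lt (mem_cliquePart.mp hl) fun h => hr (h ▸ hl)

lemma S_zero_adj {i j : Fin n} (h : (S n k 0).Adj i j) : i.val < k ∨ j.val < k := by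
  rw [S, SimpleGraph.fromRel_adj] at h
  simpa using h.2

lemma S_one_adj {i j : Fin n} (h : (S n k 1).Adj i j) : i.val < k ∨ j.val < k ∨
    (i.val = k ∧ j.val = k + 1) ∨ (j.val = k ∧ i.val = k + 1) := by
  rw [S, SimpleGraph.fromRel_adj] at h
  simp only [Nat.lt_one_iff, exists_eq_left, mul_zero, add_zero] at h
  tauto

lemma S_one_adj_pair {i j : Fin n} (hi : i.val = k) (hj : j.val = k + 1) :
    (S n k 1).Adj i j := by
  rw [S, SimpleGraph.fromRel_adj]
  exact ⟨fun h => by rw [h] at hi; omega, Or.inl (Or.inr ⟨0, by omega, by omega, by omega⟩)⟩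

lemma rho_S_bounds (hk : 1 ≤ k) (hkn : k < n) :
    0 ≤ rho (S n k p) ∧ (k : ℝ) * (n - k) ≤ rho (S n k p) ^ 2 := by
  have hc := card_cliquePart hkn.le
  have h := card_mul_card_le_rho_sq (G := S n k p) (L := cliquePart n k)
    (card_pos.mp (by omega)) (by rw [Fintype.card_fin, hc]; exact hkn) S_split
  rwa [Fintype.card_fin, hc] at h

lemma le_S_of_equiv {G : SimpleGraph (Fin n)} (e : Fin n ≃ Fin n)
    (h : ∀ a b, G.Adj a b → (S n k p).Adj (e a) (e b)) :
    ∃ G' ≤ S n k p, Nonempty (G ≃g G') := by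
  refine ⟨G.map e.toEmbedding, ?_, ⟨SimpleGraph.Iso.map e G⟩⟩
  rw [SimpleGraph.map_le_iff_le_comap]
  exact fun a b hab => h a b hab

lemma exists_equiv_extend {s : Finset (Fin n)} {f : Fin n → Fin n} (hf : Set.InjOn f s) :
    ∃ e : Fin n ≃ Fin n, ∀ i ∈ s, e i = f i := by
  obtain ⟨g, hg⟩ := Finset.exists_equiv_extend_of_card_eq (t := (univ : Finset (Fin n)))
    (by simp) (subset_univ (s.image f)) hf
  exact ⟨g.trans (Equiv.subtypeUnivEquiv mem_univ), hg⟩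

lemma exists_le_S_zero (hkn : k < n) {G : SimpleGraph (Fin n)} {M : Finset (Fin n)} (hM : #M = k)
    (h : ∀ a b, G.Adj a b → a ∈ M ∨ b ∈ M) : ∃ G' ≤ S n k 0, Nonempty (G ≃g G') := by
  have : Nonempty (Fin n) := ⟨⟨0, by omega⟩⟩
  obtain ⟨f, hf, hfM⟩ := exists_injOn_mapsTo (s := M) (t := cliquePart n k)
    (by rw [hM, card_cliquePart hkn.le])
  obtain ⟨e, he⟩ := exists_equiv_extend hf
  have heM : ∀ m ∈ M, (e m).val < k := fun m hm => by
    rw [he m hm]; exact mem_cliquePart.mp (hfM m hm)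
  refine le_S_of_equiv e fun a b hab => ?_
  have hne : e a ≠ e b := fun h => hab.ne (e.injective h)
  rcases h a b hab with ha | hb
  · exact S_adj_of_lt (heM a ha) hne
  · exact (S_adj_of_lt (heM b hb) hne.symm).symm

lemma exists_le_S_one (hkn : k + 1 < n) {G : SimpleGraph (Fin n)} {M : Finset (Fin n)}
    (hM : #M = k) {u v : Fin n} (huM : u ∉ M) (hvM : v ∉ M) (huv : u ≠ v)
    (h : ∀ a b, G.Adj a b → a ∈ M ∨ b ∈ M ∨ (a = u ∧ b = v) ∨ (a = v ∧ b = u)) :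
    ∃ G' ≤ S n k 1, Nonempty (G ≃g G') := by
  have : Nonempty (Fin n) := ⟨⟨0, by omega⟩⟩
  obtain ⟨f, hf, hfM⟩ := exists_injOn_mapsTo (s := M) (t := cliquePart n k)
    (by rw [hM, card_cliquePart (by omega)])
  set f' : Fin n → Fin n := fun i =>
    if i = u then ⟨k, by omega⟩ else if i = v then ⟨k + 1, by omega⟩ else f i with hf'
  have hu : f' u = ⟨k, by omega⟩ := by simp [hf']
  have hv : f' v = ⟨k + 1, by omega⟩ := by simp [hf', huv.symm]
  have hm : ∀ m ∈ M, f' m = f m := fun m hm => by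
    have h1 : m ≠ u := fun h => huM (h ▸ hm)
    have h2 : m ≠ v := fun h => hvM (h ▸ hm)
    simp [hf', h1, h2]
  have hlt : ∀ m ∈ M, (f' m).val < k := fun m hmM => by
    rw [hm m hmM]; exact mem_cliquePart.mp (hfM m hmM)
  have hinj : Set.InjOn f' (insert u (insert v M) : Finset (Fin n)) := by
    intro a ha b hb hab
    simp only [coe_insert, Set.mem_insert_iff, mem_coe] at ha hb
    have hab' := congrArg Fin.val hab
    rcases ha with rfl | rfl | ha <;> rcases hb with rfl | rfl | hb
    · rfl
    · rw [hu, hv] at hab'; simp at hab'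
    · have := hlt b hb; rw [hu] at hab'; simp at hab'; omega
    · rw [hu, hv] at hab'; simp at hab'
    · rfl
    · have := hlt b hb; rw [hv] at hab'; simp at hab'; omega
    · have := hlt a ha; rw [hu] at hab'; simp at hab'; omega
    · have := hlt a ha; rw [hv] at hab'; simp at hab'; omega
    · rw [hm a ha, hm b hb] at hab
      exact hf ha hb hab
  obtain ⟨e, he⟩ := exists_equiv_extend hinj
  have heM : ∀ m ∈ M, (e m).val < k := fun m hm => by
    rw [he m (by simp [hm])]; exact hlt m hm
  have heu : (e u).val = k := by rw [he u (by simp), hu]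
  have hev : (e v).val = k + 1 := by rw [he v (by simp), hv]
  refine le_S_of_equiv e fun a b hab => ?_
  have hne : e a ≠ e b := fun h => hab.ne (e.injective h)
  rcases h a b hab with ha | hb | ⟨rfl, rfl⟩ | ⟨rfl, rfl⟩
  · exact S_adj_of_lt (heM a ha) hne
  · exact (S_adj_of_lt (heM b hb) hne.symm).symm
  · exact S_one_adj_pair heu hev
  · exact (S_one_adj_pair heu hev).symm

lemma S_zero_le_S_one : S n k 0 ≤ S n k 1 := by
  intro i j h
  rcases S_zero_adj h with hi | hj
  · exact S_adj_of_lt hi h.ne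
  · exact (S_adj_of_lt hj h.ne.symm).symm

end TargetGraph

section Extremal

variable {V : Type*} {F : SimpleGraph V} {n k p : ℕ}

lemma rho_le_spex {G : SimpleGraph (Fin n)} (hG : F.Free G) : rho G ≤ spex n F := by
  refine le_csSup (Set.Finite.bddAbove ?_) ⟨G, hG, rfl⟩
  exact (Set.finite_range fun G : SimpleGraph (Fin n) => rho G).subset
    fun r ⟨G, _, hr⟩ => ⟨G, hr.symm⟩

lemma SPEX_nonempty {H : SimpleGraph (Fin n)} (hH : F.Free H) : (SPEX n F).Nonempty := by
  have hfin : {r : ℝ | ∃ G : SimpleGraph (Fin n), F.Free G ∧ r = rho G}.Finite :=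
    (Set.finite_range fun G : SimpleGraph (Fin n) => rho G).subset
      fun r ⟨G, _, hr⟩ => ⟨G, hr.symm⟩
  have hne : {r : ℝ | ∃ G : SimpleGraph (Fin n), F.Free G ∧ r = rho G}.Nonempty := ⟨_, H, hH, rfl⟩
  obtain ⟨G, hG, hr⟩ := hne.csSup_mem hfin
  exact ⟨G, hG, hr.symm⟩

lemma SPEX_eq_isoClass (hk : 1 ≤ k) (hkn : k < n) (hS : F.Free (S n k p))
    (h : ∀ G ∈ SPEX n F, ∃ G' ≤ S n k p, Nonempty (G ≃g G')) :
    SPEX n F = isoClass (S n k p) := by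
  have key : ∀ G ∈ SPEX n F, Nonempty (G ≃g S n k p) := by
    intro G hG
    obtain ⟨G', hle, ⟨e⟩⟩ := h G hG
    have hrho : rho (S n k p) ≤ rho G' := by
      rw [← rho_congr e, hG.2]
      exact rho_le_spex hS
    have := eq_of_le_of_rho_le hle (c := ⟨0, by omega⟩)
      (fun v hv => S_adj_of_lt (by simp; omega) hv.symm) hrho
    exact ⟨this ▸ e⟩
  ext G
  refine ⟨key G, ?_⟩
  rintro ⟨e⟩
  obtain ⟨H, hH⟩ := SPEX_nonempty hS
  obtain ⟨e'⟩ := key H hH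
  exact ⟨(SimpleGraph.free_congr_right e).mpr hS, by rw [rho_congr e, ← rho_congr e', hH.2]⟩

end Extremal

section Tree

variable {V : Type*} [Fintype V] {F : SimpleGraph V}

/-- In a rooted tree, parents are unique. -/
lemma eq_of_adj_of_dist_add_one {V : Type*} {F : SimpleGraph V} (hF : F.IsTree) {r a a' b : V}
    (ha : F.Adj a b) (ha' : F.Adj a' b)
    (h : F.dist r a + 1 = F.dist r b) (h' : F.dist r a' + 1 = F.dist r b) : a = a' := by
  obtain ⟨p, hp, hpl⟩ := hF.1.exists_path_of_dist r a
  obtain ⟨q, hq, hql⟩ := hF.1.exists_path_of_dist r a'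
  have key : ∀ c, ∀ p : F.Walk r c, p.IsPath → p.length = F.dist r c → F.dist r c < F.dist r b →
      b ∉ p.support := by
    intro c p _ hpl hlt hb
    have h1 := F.dist_le (p.takeUntil b hb)
    have h2 := p.length_takeUntil_le_length hb
    omega
  have hp' := hp.concat (key a p hp hpl (by omega)) ha
  have hq' := hq.concat (key a' q hq hql (by omega)) ha'
  have := congrArg (fun w : F.Path r b => w.1.penultimate) ((hF.2.subsingleton_path r b).elim ⟨_, hp'⟩ ⟨_, hq'⟩)
  simpa using this

/-- If all degrees in the partite set `A` of a tree are at least two, then `A` is the only vertex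
cover of size at most `#A`. -/
lemma subset_of_cover (hF : F.IsTree) {A : Finset V} (hA : ∀ u v, F.Adj u v → (u ∈ A ↔ v ∉ A))
    (hdeg : ∀ a ∈ A, ∃ b b', b ≠ b' ∧ F.Adj a b ∧ F.Adj a b') {C : Finset V}
    (hC : ∀ u v, F.Adj u v → u ∈ C ∨ v ∈ C) (hcard : #C ≤ #A) : A ⊆ C := by
  by_contra hcon
  obtain ⟨a₀, ha₀, ha₀C⟩ := Finset.not_subset.mp hcon
  obtain ⟨r, -, -, hr, -⟩ := hdeg a₀ ha₀
  have hout : ∀ a, a ∉ C → ∀ b, F.Adj a b → b ∈ C := fun a ha b hab => (hC a b hab).resolve_left ha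
  have hchild : ∀ a ∈ A \ C, ∃ b, F.Adj a b ∧ F.dist r b = F.dist r a + 1 := by
    intro a ha
    obtain ⟨b, b', hne, hb, hb'⟩ := hdeg a (mem_sdiff.mp ha).1
    by_contra! hno
    have h1 := hF.dist_eq_dist_add_one_of_adj r hb
    have h2 := hF.dist_eq_dist_add_one_of_adj r hb'
    have h3 := hno b hb
    have h4 := hno b' hb'
    exact hne (eq_of_adj_of_dist_add_one hF (r := r) hb.symm hb'.symm (by omega) (by omega))
  have hex : ∀ a, ∃ b, a ∈ A \ C → F.Adj a b ∧ F.dist r b = F.dist r a + 1 := fun a => by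
    by_cases ha : a ∈ A \ C
    · obtain ⟨b, hb⟩ := hchild a ha
      exact ⟨b, fun _ => hb⟩
    · exact ⟨a, fun h => absurd h ha⟩
  choose φ hφ using hex
  have hle : #(A \ C) ≤ #((C \ A).erase r) := by
    refine card_le_card_of_injOn φ (fun a ha => ?_) fun a ha a' ha' haa => ?_
    · obtain ⟨h1, h2⟩ := hφ a ha
      have ha' := mem_sdiff.mp ha
      simp only [mem_coe, mem_erase, mem_sdiff]
      refine ⟨fun h => ?_, hout a ha'.2 _ h1, (hA _ _ h1).mp ha'.1⟩
      rw [h, SimpleGraph.dist_self] at h2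
      omega
    · obtain ⟨h1, h2⟩ := hφ a ha
      obtain ⟨h3, h4⟩ := hφ a' ha'
      rw [← haa] at h3 h4
      exact eq_of_adj_of_dist_add_one hF (r := r) h1 h3 h2.symm h4.symm
  have hrC : r ∈ C \ A := mem_sdiff.mpr ⟨hout a₀ ha₀C r hr, (hA _ _ hr).mp ha₀⟩
  have h1 := card_erase_add_one hrC
  have h2 := card_sdiff_add_card_inter A C
  have h3 := card_sdiff_add_card_inter C A
  rw [inter_comm] at h3
  omega

lemma vertexCoverNum_le_card {V : Type*} {F : SimpleGraph V} {C : Finset V} (hC : ∀ u v, F.Adj u v → u ∈ C ∨ v ∈ C) :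
    F.vertexCoverNum ≤ (#C : ℕ) := by
  rw [← Set.encard_coe_eq_coe_finsetCard]
  exact SimpleGraph.IsVertexCover.vertexCoverNum_le fun u v h => hC u v h

lemma not_free_S_of_vertexCoverNum_le {n k p : ℕ} (hk : 1 ≤ k) (h : F.vertexCoverNum ≤ k)
    (hn : Fintype.card V + k ≤ n) : ¬ F.Free (S n k p) := by
  rw [SimpleGraph.not_free]
  obtain ⟨s, hs, hc⟩ := SimpleGraph.vertexCoverNum_exists F
  have hcard : #s.toFinset ≤ k := by
    rw [← hs, ← s.coe_toFinset, Set.encard_coe_eq_coe_finsetCard] at h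
    exact_mod_cast h
  have hkn : k ≤ n := by omega
  have : NeZero n := ⟨by omega⟩
  exact isContained_of_split (L := cliquePart n k) (C := s.toFinset) (D := ∅) (g := fun _ => 0)
    S_split (by rw [card_cliquePart hkn]; exact hcard)
    (fun _ _ _ _ _ l hl l' _ hll => S_adj_of_lt (mem_cliquePart.mp hl) hll)
    (disjoint_empty_right _) (by simp) (by simp)
    (fun u v hu hv huv => by
      rcases hc huv with h | h
      · exact absurd (Set.mem_toFinset.mpr h) hu
      · exact absurd (Set.mem_toFinset.mpr h) hv)
    (by rw [card_cliquePart hkn, Fintype.card_fin]; exact hn)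

end Tree

section Main

variable {V : Type*} [Fintype V] {F : SimpleGraph V} {n k : ℕ}

lemma mem_iff_notMem_of_isBipartiteWith {V : Type*} {F : SimpleGraph V} {A B : Finset V}
    (h : F.IsBipartiteWith (A : Set V) (B : Set V)) (u v : V) (huv : F.Adj u v) :
    u ∈ A ↔ v ∉ A := by
  have hdis : ∀ a ∈ A, a ∉ B := fun a ha hb => Set.disjoint_left.mp h.disjoint ha hb
  rcases h.mem_of_adj huv with ⟨h1, h2⟩ | ⟨h1, h2⟩
  · exact ⟨fun _ hv => hdis v hv h2, fun _ => h1⟩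
  · exact ⟨fun hu => absurd h1 (hdis u hu), fun hv => absurd h2 hv⟩

lemma exists_partite_set (hF : F.IsTree) :
    ∃ A : Finset V, ∀ u v, F.Adj u v → (u ∈ A ↔ v ∉ A) := by
  obtain ⟨s, t, h⟩ := hF.isBipartite.exists_isBipartiteWith
  exact ⟨s.toFinset, mem_iff_notMem_of_isBipartiteWith (B := t.toFinset) (by simpa using h)⟩

/-- Extremal graphs contain a spanning complete bipartite graph once `S n k p` has no copy of the
forbidden tree. -/
theorem exists_split_of_mem_SPEX {k l : ℕ} (hk : 1 ≤ k) (hkl : k + 1 ≤ l) :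
    ∃ N : ℕ, ∀ n, N ≤ n → ∀ (V : Type*) [Fintype V] (F : SimpleGraph V) (A : Finset V) (p : ℕ),
      Fintype.card V = l → F.IsTree → (∀ u v, F.Adj u v → (u ∈ A ↔ v ∉ A)) → #A ≤ k + 1 →
      F.Free (S n k p) → ∀ G ∈ SPEX n F,
      ∃ M : Finset (Fin n), #M = k ∧ ∀ m ∈ M, ∀ v, v ∉ M → G.Adj m v := by
  obtain ⟨N, hN⟩ := exists_complete_split hk hkl
  refine ⟨max N (k + 1), fun n hn V _ F A p hV hF hA hAk hS G hG => ?_⟩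
  have hkn : k < n := (le_max_right _ _).trans hn
  obtain ⟨h0, h1⟩ := rho_S_bounds (p := p) hk hkn
  have hle : rho (S n k p) ≤ rho G := by rw [hG.2]; exact rho_le_spex hS
  refine hN V F (Fin n) G A hV (by rw [Fintype.card_fin]; exact (le_max_left _ _).trans hn) hF hG.1
    hA hAk (fun G' hG' => by rw [hG.2]; exact rho_le_spex hG') (h0.trans hle) ?_
  rw [Fintype.card_fin]
  exact h1.trans (pow_le_pow_left₀ h0 hle 2)

/-- The preimage of the clique part under a copy of `F` in `S n k p`. -/
lemma card_preimage_cliquePart_le {f : V → Fin n} (hf : Function.Injective f) (hkn : k ≤ n) :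
    #{v | (f v).val < k} ≤ k := by
  refine (card_le_card_of_injOn f (fun v hv => ?_) hf.injOn).trans (card_cliquePart hkn).le
  exact mem_cliquePart.mpr (by simpa using hv)

lemma free_S_zero (hβ : (k : ℕ∞) < F.vertexCoverNum) (hkn : k ≤ n) : F.Free (S n k 0) := by
  rintro ⟨f⟩
  have h1 : F.vertexCoverNum ≤ (#{v | (f v).val < k} : ℕ) :=
    vertexCoverNum_le_card fun u v huv => by
      simpa using S_zero_adj (f.toHom.map_rel huv)
  have h2 : ((#{v | (f v).val < k} : ℕ) : ℕ∞) ≤ k :=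
    Nat.cast_le.mpr (card_preimage_cliquePart_le f.injective hkn)
  exact absurd hβ (not_lt.mpr (h1.trans h2))

/-- The case of trees of even order. -/
lemma SPEX_eq_of_even (hF : F.IsTree) (hk : 1 ≤ k) (hV : Fintype.card V = 2 * k + 2)
    (hn : Fintype.card V + k ≤ n) {A : Finset V} (hA : ∀ u v, F.Adj u v → (u ∈ A ↔ v ∉ A))
    (hAk : #A = k + 1) (hAk' : #Aᶜ = k + 1) (hS : F.Free (S n k 0))
    (hsplit : ∀ G ∈ SPEX n F,
      ∃ M : Finset (Fin n), #M = k ∧ ∀ m ∈ M, ∀ v, v ∉ M → G.Adj m v) :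
    SPEX n F = isoClass (S n k 0) := by
  have hnt : Nontrivial V := Fintype.one_lt_card_iff_nontrivial.mp (by omega)
  obtain ⟨x, hx⟩ := hF.exists_vert_degree_one_of_nontrivial
  obtain ⟨y, hxy, hy⟩ := SimpleGraph.degree_eq_one_iff_existsUnique_adj.mp hx
  obtain ⟨A, hA, hAk, hxA⟩ :
      ∃ A : Finset V, (∀ u v, F.Adj u v → (u ∈ A ↔ v ∉ A)) ∧ #A = k + 1 ∧ x ∈ A := by
    by_cases hxA : x ∈ A
    · exact ⟨A, hA, hAk, hxA⟩
    · refine ⟨Aᶜ, fun u v huv => ?_, hAk', by simpa using hxA⟩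
      have := hA u v huv
      simp only [mem_compl]
      tauto
  refine SPEX_eq_isoClass hk (by omega) hS fun G hG => ?_
  obtain ⟨M, hM, hMadj⟩ := hsplit G hG
  refine exists_le_S_zero (by omega) hM fun a b hab => ?_
  by_contra! hcon
  refine hG.1 (isContained_of_split (L := M) (C := A.erase x) (D := {x, y})
    (g := fun v => if v = x then a else b) hMadj ?_ ?_ ?_ ?_ ?_ ?_ ?_)
  · rw [card_erase_of_mem hxA]; omega
  · intro u hu v hv huv
    exact absurd (mem_of_mem_erase hv) ((hA u v huv).mp (mem_of_mem_erase hu))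
  · have := (hA x y hxy).mp hxA
    rw [Finset.disjoint_left]
    intro z hz hz'
    simp only [mem_insert, mem_singleton] at hz'
    rcases hz' with rfl | rfl
    · exact absurd hz (notMem_erase _ _)
    · exact this (mem_of_mem_erase hz)
  · intro u hu v hv huv
    have := hab.ne
    have := hxy.ne
    simp only [coe_insert, coe_singleton, Set.mem_insert_iff, Set.mem_singleton_iff] at hu hv
    grind
  · intro d _
    split_ifs
    · exact hcon.1
    · exact hcon.2
  · intro u v hu hv huv
    have h1 := hA u v huv
    simp only [mem_erase, not_and] at hu hv
    have h2 : (u = x ∧ v = y) ∨ (v = x ∧ u = y) := by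
      by_cases hux : u = x
      · exact Or.inl ⟨hux, hy v (hux ▸ huv)⟩
      · have hvx : v = x := by
          by_contra hvx
          exact hu hux (h1.mpr (hv hvx))
        exact Or.inr ⟨hvx, hy u (hvx ▸ huv.symm)⟩
    rcases h2 with ⟨rfl, rfl⟩ | ⟨rfl, rfl⟩
    · simp [huv.ne.symm, hab]
    · simp [huv.ne, hab.symm]
  · rw [hM, Fintype.card_fin]; exact hn

lemma not_free_S_one_of_leaf (hk : 1 ≤ k) (hn : Fintype.card V + k ≤ n) (hn' : k + 1 < n)
    {A : Finset V} (hA : ∀ u v, F.Adj u v → (u ∈ A ↔ v ∉ A)) (hAk : #A ≤ k + 1) {x y : V}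
    (hxA : x ∈ A) (hxy : F.Adj x y) (hy : ∀ z, F.Adj x z → z = y) : ¬ F.Free (S n k 1) := by
  rw [SimpleGraph.not_free]
  have hyA := (hA x y hxy).mp hxA
  have hadj : (S n k 1).Adj ⟨k, by omega⟩ ⟨k + 1, hn'⟩ := S_one_adj_pair rfl rfl
  refine isContained_of_split (L := cliquePart n k) (C := A.erase x) (D := {x, y})
    (g := fun v => if v = x then ⟨k, by omega⟩ else ⟨k + 1, hn'⟩) S_split ?_ ?_ ?_ ?_ ?_ ?_ ?_
  · rw [card_erase_of_mem hxA, card_cliquePart (by omega)]; omega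
  · exact fun _ _ _ _ _ l hl l' _ hll => S_adj_of_lt (mem_cliquePart.mp hl) hll
  · rw [Finset.disjoint_left]
    intro z hz hz'
    simp only [mem_insert, mem_singleton] at hz'
    rcases hz' with rfl | rfl
    · exact absurd hz (notMem_erase _ _)
    · exact hyA (mem_of_mem_erase hz)
  · intro u hu v hv huv
    have := hadj.ne
    simp only [coe_insert, coe_singleton, Set.mem_insert_iff, Set.mem_singleton_iff] at hu hv
    grind
  · intro d _
    rw [mem_cliquePart]
    split_ifs <;> simp
  · intro u v hu hv huv
    have h1 := hA u v huv
    simp only [mem_erase, not_and] at hu hv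
    have h2 : (u = x ∧ v = y) ∨ (v = x ∧ u = y) := by
      by_cases hux : u = x
      · exact Or.inl ⟨hux, hy v (hux ▸ huv)⟩
      · have hvx : v = x := by
          by_contra hvx
          exact hu hux (h1.mpr (hv hvx))
        exact Or.inr ⟨hvx, hy u (hvx ▸ huv.symm)⟩
    rcases h2 with ⟨rfl, rfl⟩ | ⟨rfl, rfl⟩
    · simp [huv.ne.symm, hadj]
    · simp [huv.ne, hadj.symm]
  · rw [card_cliquePart (by omega), Fintype.card_fin]; exact hn

lemma free_S_one (hF : F.IsTree) {A : Finset V} (hA : ∀ u v, F.Adj u v → (u ∈ A ↔ v ∉ A))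
    (hAk : #A = k + 1) (hdeg : ∀ a ∈ A, ∃ b b', b ≠ b' ∧ F.Adj a b ∧ F.Adj a b') (hkn : k ≤ n) :
    F.Free (S n k 1) := by
  rintro ⟨f⟩
  set C : Finset V := {v | (f v).val < k} with hC
  have hCk : #C ≤ k := card_preimage_cliquePart_le f.injective hkn
  have hfadj : ∀ u v, F.Adj u v → (S n k 1).Adj (f u) (f v) := fun u v h => f.toHom.map_rel h
  have hmem : ∀ v, v ∈ C ↔ (f v).val < k := by simp [hC]
  by_cases hcov : ∀ u v, F.Adj u v → u ∈ C ∨ v ∈ C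
  · have := card_le_card (subset_of_cover hF hA hdeg hcov (by omega))
    omega
  push Not at hcov
  obtain ⟨a, b, hab, ha, hb⟩ : ∃ a b, F.Adj a b ∧ a ∈ A ∧ (a ∉ C ∧ b ∉ C) := by
    obtain ⟨u, v, huv, hu, hv⟩ := hcov
    by_cases huA : u ∈ A
    · exact ⟨u, v, huv, huA, hu, hv⟩
    · have := hA u v huv
      exact ⟨v, u, huv.symm, by tauto, hv, hu⟩
  have hbA : b ∉ A := (hA a b hab).mp ha
  have hsub := subset_of_cover hF hA hdeg (C := insert b C) (fun u v huv => ?_)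
    ((card_insert_le _ _).trans (by omega))
  · have := hsub ha
    rw [mem_insert] at this
    exact this.elim (fun h => hab.ne h) hb.1
  · by_contra! hcon
    simp only [mem_insert, not_or] at hcon
    have h1 := S_one_adj (hfadj u v huv)
    have h2 := S_one_adj (hfadj a b hab)
    rw [hmem, hmem] at hb hcon
    have h3 : f u = f b ∨ f v = f b := by
      simp only [Fin.ext_iff]
      omega
    rcases h3 with h | h
    · exact hcon.1.1 (f.injective h)
    · exact hcon.2.1 (f.injective h)

/-- Two edges outside the part of size `k` of a spanning complete bipartite graph that share a
vertex give a copy of a tree whose partite set `A` has a vertex of degree two. -/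
lemma isContained_of_cherry {G : SimpleGraph (Fin n)} {M : Finset (Fin n)}
    (hMadj : ∀ m ∈ M, ∀ v, v ∉ M → G.Adj m v) (hn : Fintype.card V + #M ≤ n)
    {A : Finset V} (hA : ∀ u v, F.Adj u v → (u ∈ A ↔ v ∉ A)) (hAM : #A ≤ #M + 1) {x y z : V}
    (hxA : x ∈ A) (hxy : F.Adj x y) (hxz : F.Adj x z) (hx : ∀ w, F.Adj x w → w = y ∨ w = z)
    (hyz : y ≠ z) {a b c : Fin n} (haM : a ∉ M) (hbM : b ∉ M) (hcM : c ∉ M) (hab : G.Adj a b)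
    (hac : G.Adj a c) (hbc : b ≠ c) : F.IsContained G := by
  have hyA := (hA x y hxy).mp hxA
  have hzA := (hA x z hxz).mp hxA
  refine isContained_of_split (L := M) (C := A.erase x) (D := {x, y, z})
    (g := fun v => if v = x then a else if v = y then b else c) hMadj ?_ ?_ ?_ ?_ ?_ ?_ ?_
  · rw [card_erase_of_mem hxA]; omega
  · intro u hu v hv huv
    exact absurd (mem_of_mem_erase hv) ((hA u v huv).mp (mem_of_mem_erase hu))
  · rw [Finset.disjoint_left]
    intro w hw hw'
    simp only [mem_insert, mem_singleton] at hw'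
    rcases hw' with rfl | rfl | rfl
    · exact absurd hw (notMem_erase _ _)
    · exact hyA (mem_of_mem_erase hw)
    · exact hzA (mem_of_mem_erase hw)
  · intro u hu v hv huv
    have := hab.ne
    have := hac.ne
    simp only [coe_insert, coe_singleton, Set.mem_insert_iff, Set.mem_singleton_iff] at hu hv
    grind
  · intro d _
    split_ifs <;> assumption
  · intro u v hu hv huv
    have h1 := hA u v huv
    simp only [mem_erase, not_and] at hu hv
    have h2 : (u = x ∧ (v = y ∨ v = z)) ∨ (v = x ∧ (u = y ∨ u = z)) := by
      by_cases hux : u = x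
      · exact Or.inl ⟨hux, hx v (hux ▸ huv)⟩
      · have hvx : v = x := by
          by_contra hvx
          exact hu hux (h1.mpr (hv hvx))
        exact Or.inr ⟨hvx, hx u (hvx ▸ huv.symm)⟩
    rcases h2 with ⟨rfl, rfl | rfl⟩ | ⟨rfl, rfl | rfl⟩
    · simp [huv.ne.symm, hab]
    · simp [huv.ne.symm, hac, hyz.symm]
    · simp [huv.ne, hab.symm]
    · simp [huv.ne, hac.symm, hyz.symm]
  · rw [Fintype.card_fin]; exact hn

/-- Two disjoint edges outside the part of size `k` of a spanning complete bipartite graph give a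
copy of a tree having two leaves in a partite set of size `k + 2`. -/
lemma isContained_of_two_edges {G : SimpleGraph (Fin n)} {M : Finset (Fin n)}
    (hMadj : ∀ m ∈ M, ∀ v, v ∉ M → G.Adj m v) (hn : Fintype.card V + #M ≤ n)
    {A : Finset V} (hA : ∀ u v, F.Adj u v → (u ∈ A ↔ v ∉ A)) (hAM : #Aᶜ ≤ #M + 2)
    {x y x' y' : V} (hyA : y ∉ A) (hyA' : y' ∉ A) (hyx : F.Adj y x) (hyx' : F.Adj y' x')
    (hy : ∀ w, F.Adj y w → w = x) (hy' : ∀ w, F.Adj y' w → w = x') (hyy : y ≠ y') (hxx : x ≠ x')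
    {a b a' b' : Fin n} (haM : a ∉ M) (hbM : b ∉ M) (haM' : a' ∉ M) (hbM' : b' ∉ M)
    (hab : G.Adj a b) (hab' : G.Adj a' b') (haa : a ≠ a') (hba : a ≠ b') (hba' : b ≠ a')
    (hbb : b ≠ b') : F.IsContained G := by
  have hxA : x ∈ A := by have := hA y x hyx; tauto
  have hxA' : x' ∈ A := by have := hA y' x' hyx'; tauto
  have hne : ∀ {s t : V}, s ∈ A → t ∉ A → s ≠ t := fun hs ht h => ht (h ▸ hs)
  have h1 := hne hxA hyA
  have h2 := hne hxA hyA'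
  have h3 := hne hxA' hyA
  have h4 := hne hxA' hyA'
  refine isContained_of_split (L := M) (C := (Aᶜ.erase y).erase y') (D := {x, y, x', y'})
    (g := fun v => if v = x then a else if v = y then b else if v = x' then a' else b')
    hMadj ?_ ?_ ?_ ?_ ?_ ?_ ?_
  · rw [card_erase_of_mem, card_erase_of_mem]
    · omega
    · simpa using hyA
    · simpa [hyy.symm] using hyA'
  · intro u hu v hv huv
    have := hA u v huv
    simp only [mem_erase, mem_compl] at hu hv
    tauto
  · rw [Finset.disjoint_left]
    intro w hw hw'
    simp only [mem_insert, mem_singleton, mem_erase, mem_compl] at hw hw'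
    rcases hw' with rfl | rfl | rfl | rfl <;> tauto
  · intro u hu v hv huv
    have := hab.ne
    have := hab'.ne
    simp only [coe_insert, coe_singleton, Set.mem_insert_iff, Set.mem_singleton_iff] at hu hv
    grind
  · intro d _
    split_ifs <;> assumption
  · have key : ∀ u v, u ∉ A → u ∉ (Aᶜ.erase y).erase y' → F.Adj u v →
        (u = y ∧ v = x) ∨ (u = y' ∧ v = x') := by
      intro u v huA hu huv
      simp only [mem_erase, mem_compl, not_and, not_not] at hu
      by_cases huy' : u = y'
      · exact Or.inr ⟨huy', hy' v (huy' ▸ huv)⟩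
      · have huy : u = y := by
          by_contra huy
          exact huA (hu huy' huy)
        exact Or.inl ⟨huy, hy v (huy ▸ huv)⟩
    intro u v hu hv huv
    by_cases huA : u ∈ A
    · rcases key v u ((hA u v huv).mp huA) hv huv.symm with ⟨rfl, rfl⟩ | ⟨rfl, rfl⟩
      · simp [h1.symm, hab]
      · simp [h2.symm, h3, h4.symm, hyy.symm, hxx.symm, hab']
    · rcases key u v huA hu huv with ⟨rfl, rfl⟩ | ⟨rfl, rfl⟩
      · simp [h1.symm, hab.symm]
      · simp [h2.symm, h3, h4.symm, hyy.symm, hxx.symm, hab'.symm]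
  · rw [Fintype.card_fin]; exact hn

/-- The case of trees of odd order. -/
lemma SPEX_eq_of_odd (hF : F.IsTree) (hk : 1 ≤ k) (hV : Fintype.card V = 2 * k + 3)
    (hn : Fintype.card V + k ≤ n) {A B : Finset V}
    (hAB : F.IsBipartiteWith (A : Set V) (B : Set V))
    (hAk : #A = k + 1) (hdeg : ∀ a ∈ A, 2 ≤ F.degree a) (hS : F.Free (S n k 1))
    (hsplit : ∀ G ∈ SPEX n F,
      ∃ M : Finset (Fin n), #M = k ∧ ∀ m ∈ M, ∀ v, v ∉ M → G.Adj m v) :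
    SPEX n F = isoClass (S n k 1) := by
  have hA := mem_iff_notMem_of_isBipartiteWith hAB
  have hAc : #Aᶜ = k + 2 := by rw [card_compl]; omega
  have hnt : Nontrivial V := Fintype.one_lt_card_iff_nontrivial.mp (by omega)
  have hsum : ∑ a ∈ A, F.degree a = ∑ a ∈ A, 2 := by
    rw [SimpleGraph.isBipartiteWith_sum_degrees_eq_card_edges hAB, sum_const, hAk, smul_eq_mul]
    have := hF.card_edgeFinset
    omega
  have hdeg2 : ∀ a ∈ A, F.degree a = 2 := fun a ha =>
    ((sum_eq_sum_iff_of_le hdeg).mp hsum.symm a ha).symm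
  have hnbr : ∀ a ∈ A, ∃ y z, y ≠ z ∧ F.neighborFinset a = {y, z} := fun a ha =>
    card_eq_two.mp (hdeg2 a ha)
  obtain ⟨x, hxA⟩ := card_pos.mp (by omega : 0 < #A)
  obtain ⟨y, z, hyz, hxn⟩ := hnbr x hxA
  have hxn' : ∀ w, F.Adj x w ↔ w = y ∨ w = z := fun w => by
    rw [← F.mem_neighborFinset, hxn]; simp
  obtain ⟨b₁, b₂, hbb, hb₁, hb₂⟩ := hF.exists_ne_and_degree_eq_one
  obtain ⟨a₁, hab₁, ha₁⟩ := SimpleGraph.degree_eq_one_iff_existsUnique_adj.mp hb₁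
  obtain ⟨a₂, hab₂, ha₂⟩ := SimpleGraph.degree_eq_one_iff_existsUnique_adj.mp hb₂
  have hbA₁ : b₁ ∉ A := fun h => by have := hdeg b₁ h; omega
  have hbA₂ : b₂ ∉ A := fun h => by have := hdeg b₂ h; omega
  have haa : a₁ ≠ a₂ := by
    rintro rfl
    have haA : a₁ ∈ A := by have := hA _ _ hab₁; tauto
    obtain ⟨s, t, -, hst⟩ := hnbr a₁ haA
    have hsub : ({b₁, b₂} : Finset V) = {s, t} := by
      rw [← hst]
      refine eq_of_subset_of_card_le ?_ ?_
      · intro w hw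
        simp only [mem_insert, mem_singleton] at hw
        rw [F.mem_neighborFinset]
        rcases hw with rfl | rfl
        · exact hab₁.symm
        · exact hab₂.symm
      · rw [card_pair hbb]
        exact (hdeg2 a₁ haA).le
    have hadj : ∀ w, F.Adj a₁ w → w = b₁ ∨ w = b₂ := fun w hw => by
      rw [← F.mem_neighborFinset, hst, ← hsub] at hw
      simpa using hw
    have hall : ∀ v, v = a₁ ∨ v = b₁ ∨ v = b₂ := by
      have hstep : ∀ v w, F.Adj v w → (v = a₁ ∨ v = b₁ ∨ v = b₂) → (w = a₁ ∨ w = b₁ ∨ w = b₂) := by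
        rintro v w hvw (rfl | rfl | rfl)
        · exact Or.inr (hadj w hvw)
        · exact Or.inl (ha₁ w hvw)
        · exact Or.inl (ha₂ w hvw)
      have hwalk : ∀ v w, F.Walk v w → (v = a₁ ∨ v = b₁ ∨ v = b₂) →
          (w = a₁ ∨ w = b₁ ∨ w = b₂) := by
        intro v w p
        induction p with
        | nil => exact id
        | cons h _ ih => exact fun hv => ih (hstep _ _ h hv)
      intro v
      obtain ⟨p⟩ := hF.1.preconnected a₁ v
      exact hwalk _ _ p (Or.inl rfl)
    have : Fintype.card V ≤ #({a₁, b₁, b₂} : Finset V) := by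
      rw [← card_univ]
      exact card_le_card fun v _ => by simpa using hall v
    have := this.trans card_le_three
    omega
  refine SPEX_eq_isoClass hk (by omega) hS fun G hG => ?_
  obtain ⟨M, hM, hMadj⟩ := hsplit G hG
  by_cases hedge : ∀ a b, G.Adj a b → a ∈ M ∨ b ∈ M
  · obtain ⟨G', hle, hiso⟩ := exists_le_S_zero (by omega) hM hedge
    exact ⟨G', hle.trans S_zero_le_S_one, hiso⟩
  push Not at hedge
  obtain ⟨u, v, huv, huM, hvM⟩ := hedge
  have hcherry : ∀ a b c, a ∉ M → b ∉ M → c ∉ M → G.Adj a b → G.Adj a c → b = c := by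
    intro a b c ha hb hc hab hac
    by_contra hbc
    exact hG.1 (isContained_of_cherry hMadj (by omega) hA (by omega) hxA ((hxn' y).mpr (Or.inl rfl))
      ((hxn' z).mpr (Or.inr rfl)) (fun w => (hxn' w).mp) hyz ha hb hc hab hac hbc)
  refine exists_le_S_one (by omega) hM huM hvM huv.ne fun a b hab => ?_
  by_contra! hcon
  obtain ⟨ha, hb, h1, h2⟩ := hcon
  have e1 : u ≠ a := fun h => h1 h.symm (hcherry u b v huM hb hvM (h ▸ hab) huv)
  have e2 : v ≠ b := fun h => h1 (hcherry v a u hvM ha huM (h ▸ hab.symm) huv.symm) h.symm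
  have e3 : u ≠ b := fun h => h2 (hcherry u a v huM ha hvM (h ▸ hab.symm) huv) h.symm
  have e4 : v ≠ a := fun h => h2 h.symm (hcherry v b u hvM hb huM (h ▸ hab) huv.symm)
  exact hG.1 (isContained_of_two_edges hMadj (by omega) hA (by omega) hbA₁ hbA₂ hab₁ hab₂ ha₁ ha₂
    hbb haa huM hvM ha hb huv hab e1 e3 e4 e2)

end Main

section Equivalences

variable {V : Type*} [Fintype V] {F : SimpleGraph V} {n k : ℕ}

lemma isoClass_self_mem (H : SimpleGraph (Fin n)) : H ∈ isoClass H := ⟨SimpleGraph.Iso.refl⟩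

lemma lt_vertexCoverNum_of_SPEX_eq {p : ℕ} (hk : 1 ≤ k) (hn : Fintype.card V + k ≤ n)
    (h : SPEX n F = isoClass (S n k p)) : ((k + 1 : ℕ) : ℕ∞) ≤ F.vertexCoverNum := by
  have hS : S n k p ∈ SPEX n F := h ▸ isoClass_self_mem _
  by_contra! hlt
  have hle : F.vertexCoverNum ≤ k := by
    rw [Nat.cast_succ] at hlt
    exact Order.le_of_lt_add_one hlt
  exact not_free_S_of_vertexCoverNum_le hk hle hn hS.1

lemma vertexCoverNum_le_partite {A : Finset V} (hA : ∀ u v, F.Adj u v → (u ∈ A ↔ v ∉ A)) :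
    F.vertexCoverNum ≤ (#A : ℕ) ∧ F.vertexCoverNum ≤ (#Aᶜ : ℕ) := by
  constructor <;> refine vertexCoverNum_le_card fun u v huv => ?_
  · have := hA u v huv
    tauto
  · have := hA u v huv
    simp only [mem_compl]
    tauto

theorem SPEX_eq_iff_of_even (hF : F.IsTree) (hk : 1 ≤ k) (hV : Fintype.card V = 2 * k + 2)
    (hn : Fintype.card V + k ≤ n)
    (hsplit : ∀ (A : Finset V), (∀ u v, F.Adj u v → (u ∈ A ↔ v ∉ A)) → #A ≤ k + 1 →
      F.Free (S n k 0) → ∀ G ∈ SPEX n F,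
      ∃ M : Finset (Fin n), #M = k ∧ ∀ m ∈ M, ∀ v, v ∉ M → G.Adj m v) :
    SPEX n F = isoClass (S n k 0) ↔ F.vertexCoverNum = ((k + 1 : ℕ) : ℕ∞) := by
  obtain ⟨A, hA⟩ := exists_partite_set hF
  obtain ⟨h1, h2⟩ := vertexCoverNum_le_partite hA
  have hsum := card_add_card_compl A
  constructor
  · intro h
    refine le_antisymm ?_ (lt_vertexCoverNum_of_SPEX_eq hk hn h)
    rcases le_total (#A) (#Aᶜ) with hle | hle
    · exact h1.trans (Nat.cast_le.mpr (by omega))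
    · exact h2.trans (Nat.cast_le.mpr (by omega))
  · intro hβ
    rw [hβ] at h1 h2
    have h1' : k + 1 ≤ #A := by exact_mod_cast h1
    have h2' : k + 1 ≤ #Aᶜ := by exact_mod_cast h2
    have hS : F.Free (S n k 0) := free_S_zero
      (by rw [hβ]; exact Nat.cast_lt.mpr (Nat.lt_succ_self k)) (by omega)
    exact SPEX_eq_of_even hF hk hV hn hA (by omega) (by omega) hS (hsplit A hA (by omega) hS)

lemma two_le_minDegreeOn_iff {A : Finset V} (hA : A.Nonempty) :
    2 ≤ minDegreeOn F A ↔ ∀ a ∈ A, 2 ≤ F.degree a := by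
  have hdef : minDegreeOn F A = sInf {d : ℕ | ∃ x ∈ A, d = F.degree x} := by
    unfold minDegreeOn
    congr!
  rw [hdef]
  constructor
  · exact fun h a ha => h.trans (Nat.sInf_le ⟨a, ha, rfl⟩)
  · intro h
    obtain ⟨a, ha⟩ := hA
    obtain ⟨x, hx, hd⟩ := Nat.sInf_mem (⟨_, a, ha, rfl⟩ : {d : ℕ | ∃ x ∈ A, d = F.degree x}.Nonempty)
    rw [hd]
    exact h x hx

theorem SPEX_eq_iff_of_odd (hF : F.IsTree) (hk : 1 ≤ k) (hV : Fintype.card V = 2 * k + 3)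
    (hn : Fintype.card V + k ≤ n) {A B : Finset V}
    (hAB : F.IsBipartiteWith (A : Set V) (B : Set V)) (hcard : #A ≤ #B)
    (hsplit : ∀ (A : Finset V), (∀ u v, F.Adj u v → (u ∈ A ↔ v ∉ A)) → #A ≤ k + 1 →
      F.Free (S n k 1) → ∀ G ∈ SPEX n F,
      ∃ M : Finset (Fin n), #M = k ∧ ∀ m ∈ M, ∀ v, v ∉ M → G.Adj m v) :
    SPEX n F = isoClass (S n k 1) ↔
      F.vertexCoverNum = ((k + 1 : ℕ) : ℕ∞) ∧ 2 ≤ minDegreeOn F A := by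
  have hA := mem_iff_notMem_of_isBipartiteWith hAB
  have h1 := (vertexCoverNum_le_partite hA).1
  have hAk : #A ≤ k + 1 := by
    have h2 := card_union_of_disjoint (Finset.disjoint_coe.mp hAB.disjoint)
    have h3 := card_le_univ (A ∪ B)
    omega
  have hnt : Nontrivial V := Fintype.one_lt_card_iff_nontrivial.mp (by omega)
  constructor
  · intro h
    have hβ := lt_vertexCoverNum_of_SPEX_eq hk hn h
    have hAk' : k + 1 ≤ #A := by exact_mod_cast hβ.trans h1
    refine ⟨le_antisymm (h1.trans (Nat.cast_le.mpr hAk)) hβ, ?_⟩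
    rw [two_le_minDegreeOn_iff (card_pos.mp (by omega))]
    intro x hx
    by_contra! hlt
    have hpos := hF.1.preconnected.degree_pos_of_nontrivial x
    obtain ⟨y, hxy, hy⟩ := SimpleGraph.degree_eq_one_iff_existsUnique_adj.mp
      (by omega : F.degree x = 1)
    have hS : S n k 1 ∈ SPEX n F := h ▸ isoClass_self_mem _
    exact not_free_S_one_of_leaf hk hn (by omega) hA hAk hx hxy hy hS.1
  · rintro ⟨hβ, hδ⟩
    rw [hβ] at h1
    have hAk' : #A = k + 1 := le_antisymm hAk (by exact_mod_cast h1)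
    rw [two_le_minDegreeOn_iff (card_pos.mp (by omega))] at hδ
    have hS : F.Free (S n k 1) := by
      refine free_S_one hF hA hAk' (fun a ha => ?_) (by omega)
      obtain ⟨b, hb, b', hb', hne⟩ := one_lt_card.mp (hδ a ha)
      exact ⟨b, b', hne, (F.mem_neighborFinset a b).mp hb, (F.mem_neighborFinset a b').mp hb'⟩
    exact SPEX_eq_of_odd hF hk hV hn hAB hAk' hδ hS (hsplit A hA hAk hS)

end Equivalences

end SpectralTuran

theorem theorem1p3 (ℓ : ℕ) (hℓ : 4 ≤ ℓ) :
    ∃ N : ℕ, ∀ n : ℕ, N ≤ n →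
      ∀ (V : Type*) [Fintype V] (F : SimpleGraph V), F.IsTree → Fintype.card V = ℓ →
        (Even ℓ →
          (SpectralTuran.SPEX n F =
              SpectralTuran.isoClass (SpectralTuran.S n ((ℓ - 2) / 2) 0) ↔
            F.vertexCoverNum = ((ℓ / 2 : ℕ) : ℕ∞))) ∧
        (Odd ℓ →
          ∀ A B : Finset V, F.IsBipartiteWith (A : Set V) (B : Set V) → A.card ≤ B.card →
            (SpectralTuran.SPEX n F =
                SpectralTuran.isoClass (SpectralTuran.S n ((ℓ - 3) / 2) 1) ↔
              F.vertexCoverNum = (((ℓ - 1) / 2 : ℕ) : ℕ∞) ∧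
                2 ≤ SpectralTuran.minDegreeOn F A)) := by
  rcases Nat.even_or_odd' ℓ with ⟨m, rfl | rfl⟩
  · obtain ⟨k, rfl⟩ : ∃ k, m = k + 1 := ⟨m - 1, by omega⟩
    obtain ⟨N, hN⟩ := SpectralTuran.exists_split_of_mem_SPEX (k := k) (l := 2 * (k + 1))
      (by omega) (by omega)
    refine ⟨max N (2 * (k + 1) + k), fun n hn V _ F hF hV => ⟨fun _ => ?_, fun hodd => ?_⟩⟩
    · rw [show (2 * (k + 1) - 2) / 2 = k by omega, show 2 * (k + 1) / 2 = k + 1 by omega]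
      exact SpectralTuran.SPEX_eq_iff_of_even hF (by omega) (by omega)
        (by rw [hV]; exact (le_max_right _ _).trans hn)
        fun A => hN n ((le_max_left _ _).trans hn) V F A 0 hV hF
    · exact absurd hodd (by simp [Nat.not_odd_iff_even])
  · obtain ⟨k, rfl⟩ : ∃ k, m = k + 1 := ⟨m - 1, by omega⟩
    obtain ⟨N, hN⟩ := SpectralTuran.exists_split_of_mem_SPEX (k := k) (l := 2 * (k + 1) + 1)
      (by omega) (by omega)
    refine ⟨max N (2 * (k + 1) + 1 + k), fun n hn V _ F hF hV => ⟨fun heven => ?_, ?_⟩⟩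
    · exact absurd heven (by simp)
    · intro _ A B hAB hcard
      rw [show (2 * (k + 1) + 1 - 3) / 2 = k by omega,
        show (2 * (k + 1) + 1 - 1) / 2 = k + 1 by omega]
      exact SpectralTuran.SPEX_eq_iff_of_odd hF (by omega) (by omega)
        (by rw [hV]; exact (le_max_right _ _).trans hn) hAB hcard
        fun A => hN n ((le_max_left _ _).trans hn) V F A 1 hV hF
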